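/- **Theorem (joint density of the eigenvalues).** Let $\mathfrak F$ be an associative finite-dimensional real normed division algebra, i.e. $\mathfrak F=\mathbb R$, $\mathbb C$ or the quaternions $\mathbb H$, with its usual norm and conjugation, and let $\beta=\dim_{\mathbb R}\mathfrak F\in\{1,2,4\}$. For an $m\times m$ matrix $A$ over $\mathfrak F$ let $A^*$ be its conjugate transpose. Let $\mathfrak P_m^\beta$ be the set of positive definite Hermitian $m\times m$ matrices $S$ over $\mathfrak F$ (that is, $S=S^*$ and $x^*Sx>0$ for all $0\neq x\in\mathfrak F^m$), with the Lebesgue measure $(dS)=\prod_{i}ds_{ii}\prod_{i<j}ds_{ij}$, where $ds_{ii}$ is Lebesgue measure on $\mathbb R$ and $ds_{ij}$, $i<j$, is the product of the Lebesgue measures of the $\beta$ real coordinates of $s_{ij}\in\mathfrak F$. Let $\mathfrak U^\beta(m)$ be the compact group of $m\times m$ matrices $H$ over $\mathfrak F$ with $H^*H=I_m$, and let $(dH)$ be its Haar measure of total mass $1$. Let $X$ be a random matrix in $\mathfrak P_m^\beta$ whose law has density $f$ with respect to $(dS)$, with $f\ge 0$ measurable. Then the vector of the eigenvalues of $X$,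 listed with multiplicity in decreasing order, has a joint density with respect to Lebesgue measure on $\mathbb R^m$; this density is $$\frac{\pi^{m^2\beta/2+\varrho}}{\Gamma_m^\beta[m\beta/2]}\;\prod_{1\le i<j\le m}(\lambda_i-\lambda_j)^\beta\int_{\mathfrak U^\beta(m)}f(HLH^*)\,(dH),\qquad L=\operatorname{diag}(\lambda_1,\dots,\lambda_m),$$ on $\{\lambda_1>\lambda_2>\cdots>\lambda_m>0\}$, and $0$ elsewhere. Here $$\Gamma_m^\beta[a]=\pi^{m(m-1)\beta/4}\prod_{i=1}^m\Gamma\!\left(a-\tfrac{(i-1)\beta}{2}\right),\qquad \varrho=\begin{cases}0,&\beta=1,\\-m,&\beta=2,\\-2m,&\beta=4.\end{cases}$$ -/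

import Mathlib

open MeasureTheory
open scoped Matrix Quaternion

/-- An associative, finite-dimensional real normed division algebra together with its conjugation
`star`: the norm is multiplicative (this is part of `NormedDivisionRing`), it comes from a real
inner product, the reals are central, and `star x * x = ‖x‖ ^ 2`.  The (only) examples are
`ℝ`, `ℂ` and the quaternions, with their usual norms and conjugations; see the instances below. -/
class RealNormedDivisionAlgebra (F : Type*) [NormedDivisionRing F] [InnerProductSpace ℝ F]
    [StarRing F] : Prop where
  finiteDimensional : FiniteDimensional ℝ F
  isScalarTower : IsScalarTower ℝ F F
  smulCommClass : SMulCommClass ℝ F F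
  star_mul_self : ∀ x : F, star x * x = (‖x‖ ^ 2) • (1 : F)

attribute [instance] RealNormedDivisionAlgebra.finiteDimensional
  RealNormedDivisionAlgebra.isScalarTower RealNormedDivisionAlgebra.smulCommClass

instance : RealNormedDivisionAlgebra ℝ where
  finiteDimensional := inferInstance
  isScalarTower := inferInstance
  smulCommClass := inferInstance
  star_mul_self x := by simp [sq]

instance : RealNormedDivisionAlgebra ℂ where
  finiteDimensional := inferInstance
  isScalarTower := inferInstance
  smulCommClass := inferInstance
  star_mul_self x := by
    rw [Complex.star_def, ← Complex.normSq_eq_conj_mul_self, Complex.normSq_eq_norm_sq]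
    simp

instance : RealNormedDivisionAlgebra ℍ[ℝ] where
  finiteDimensional := inferInstance
  isScalarTower := inferInstance
  smulCommClass := inferInstance
  star_mul_self x := by
    rw [Quaternion.star_mul_self, Quaternion.normSq_eq_norm_mul_self, sq,
      ← Quaternion.coe_mul_eq_smul, mul_one]

namespace RealNormedDivisionAlgebra

variable {F : Type*} [NormedDivisionRing F] [InnerProductSpace ℝ F] [StarRing F]
  [RealNormedDivisionAlgebra F]

theorem norm_star (x : F) : ‖star x‖ = ‖x‖ := by
  by_cases hx : x = 0
  · simp [hx]
  · have h := congrArg norm (star_mul_self x)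
    rw [norm_mul, norm_smul, norm_one, mul_one, norm_pow, norm_norm, sq] at h
    exact mul_right_cancel₀ (norm_ne_zero_iff.2 hx) h

instance : ContinuousStar F where
  continuous_star := by
    have h : Isometry (starAddEquiv : F ≃+ F) :=
      AddMonoidHomClass.isometry_of_norm _ norm_star
    exact h.continuous

end RealNormedDivisionAlgebra

section Definitions

variable (F : Type*) [NormedDivisionRing F] [InnerProductSpace ℝ F] [StarRing F]
  [RealNormedDivisionAlgebra F] (m : ℕ)

/-- The group `𝔘(m)` of the `m × m` matrices `H` over `F` with `Hᴴ * H = 1` (and `H * Hᴴ = 1`). -/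
abbrev UGroup : Type _ := unitary (Matrix (Fin m) (Fin m) F)

instance UGroup.instCompactSpace : CompactSpace (UGroup F m) := by
  have : ProperSpace F := FiniteDimensional.proper_real F
  refine isCompact_iff_compactSpace.1 ?_
  have hK : IsCompact
      {A : Matrix (Fin m) (Fin m) F | ∀ i j, A i j ∈ Metric.closedBall (0 : F) 1} := by
    have h := isCompact_univ_pi (X := fun _ : Fin m => Fin m → F)
      (s := fun _ => Set.univ.pi fun _ => Metric.closedBall (0 : F) 1)
      (fun _ => isCompact_univ_pi fun _ => isCompact_closedBall (0 : F) 1)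
    have e : {A : Matrix (Fin m) (Fin m) F | ∀ i j, A i j ∈ Metric.closedBall (0 : F) 1} =
        Set.univ.pi fun _ => Set.univ.pi fun _ => Metric.closedBall (0 : F) 1 := by
      apply Set.ext
      intro A
      exact ⟨fun hA i _ j _ => hA i j, fun hA i j => hA i trivial j trivial⟩
    exact e ▸ h
  refine hK.of_isClosed_subset ?_ ?_
  · exact isClosed_unitary
  · intro A hA i j
    have h := congrFun (congrFun (Unitary.mem_iff.1 hA).1 j) j
    rw [Matrix.mul_apply, Matrix.one_apply_eq] at h
    simp only [Matrix.star_apply, RealNormedDivisionAlgebra.star_mul_self] at h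
    rw [← Finset.sum_smul] at h
    have h1 : (∑ x, ‖A x j‖ ^ 2 : ℝ) = 1 :=
      smul_left_injective ℝ (one_ne_zero (α := F)) (by simpa using h)
    have h2 : ‖A i j‖ ^ 2 ≤ 1 := h1 ▸ Finset.single_le_sum (f := fun x => ‖A x j‖ ^ 2)
      (fun _ _ => sq_nonneg _) (Finset.mem_univ i)
    rw [mem_closedBall_zero_iff]
    nlinarith [norm_nonneg (A i j)]

section Measures

/-- Matrices carry the product `σ`-algebra of their entries, which is the Borel `σ`-algebra. -/
instance Matrix.instMeasurableSpaceFin (F : Type*) [MeasurableSpace F] (m : ℕ) :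
    MeasurableSpace (Matrix (Fin m) (Fin m) F) :=
  inferInstanceAs (MeasurableSpace (Fin m → Fin m → F))

variable [MeasurableSpace F] [BorelSpace F]

instance Matrix.instBorelSpaceFin : BorelSpace (Matrix (Fin m) (Fin m) F) :=
  haveI : ProperSpace F := FiniteDimensional.proper_real F
  inferInstanceAs (BorelSpace (Fin m → Fin m → F))

/-- The normalised Haar measure `(dH)` on `𝔘(m)`: the Haar measure of total mass one. -/
noncomputable def haarU : Measure (UGroup F m) := Measure.haarMeasure ⊤

variable {F m} in
/-- The Hermitian matrix with real diagonal entries `d i` and entries `u (i, j)` for `i < j`. -/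
def hermitianOfCoords
    (c : (Fin m → ℝ) × ({p : Fin m × Fin m // p.1 < p.2} → F)) : Matrix (Fin m) (Fin m) F :=
  Matrix.of fun i j =>
    if h : i < j then c.2 ⟨(i, j), h⟩
    else if h' : j < i then star (c.2 ⟨(j, i), h'⟩)
    else c.1 i • (1 : F)

variable {F m} in
theorem measurable_hermitianOfCoords : Measurable (hermitianOfCoords (F := F) (m := m)) := by
  have : ProperSpace F := FiniteDimensional.proper_real F
  refine Continuous.measurable (continuous_matrix fun i j => ?_)
  unfold hermitianOfCoords
  simp only [Matrix.of_apply]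
  split_ifs <;> fun_prop

/-- The Lebesgue measure `(dS) = ∏ᵢ dsᵢᵢ ∏_{i<j} dsᵢⱼ` on the Hermitian matrices over `F`,
regarded as a measure on all matrices that is carried by the Hermitian ones.  Here `dsᵢⱼ` is the
Lebesgue measure of the Euclidean space `F`, i.e. the product of the Lebesgue measures of the
real coordinates with respect to an orthonormal basis such as `1`, or `1, i`, or `1, i, j, k`. -/
noncomputable def hermitianVolume : Measure (Matrix (Fin m) (Fin m) F) :=
  (volume : Measure ((Fin m → ℝ) × ({p : Fin m × Fin m // p.1 < p.2} → F))).map hermitianOfCoords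

end Measures

variable {F m}

/-- Positive definite Hermitian matrices over `F`: `Sᴴ = S` and `x* S x > 0` for `x ≠ 0`.  As `S`
is Hermitian, `x* S x` is a real multiple of `1`, and `⟪1, a⟫` is the real part of `a`. -/
def IsPosDefHermitian (S : Matrix (Fin m) (Fin m) F) : Prop :=
  S.IsHermitian ∧ ∀ x : Fin m → F, x ≠ 0 → 0 < inner ℝ (1 : F) (star x ⬝ᵥ (S *ᵥ x))

/-- The (right) eigenspace `{v | S v = v t}` of the real number `t`, as a real vector space. -/
def realEigenspace (S : Matrix (Fin m) (Fin m) F) (t : ℝ) : Submodule ℝ (Fin m → F) where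
  carrier := {v | S *ᵥ v = t • v}
  add_mem' {v w} hv hw := by
    simp only [Set.mem_ofPred_eq] at *
    rw [Matrix.mulVec_add, hv, hw, smul_add]
  zero_mem' := by simp
  smul_mem' c v hv := by
    simp only [Set.mem_ofPred_eq] at *
    rw [Matrix.mulVec_smul, hv, smul_comm]

/-- `l` lists the eigenvalues of `S` in decreasing order, each repeated according to its
multiplicity, the dimension over `F` of the eigenspace, which is its real dimension divided by the
real dimension of `F`.  (The eigenvalues of a Hermitian matrix are real.) -/
def IsOrderedEigenvalues (S : Matrix (Fin m) (Fin m) F) (l : Fin m → ℝ) : Prop :=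
  Antitone l ∧ ∀ t : ℝ, Module.finrank ℝ (realEigenspace S t) =
    Module.finrank ℝ F * (Finset.univ.filter fun i => l i = t).card

open Classical in
/-- The eigenvalues `λ₁ ≥ ⋯ ≥ λₘ` of `S`, with multiplicity (a junk value if there is no such
list; there is exactly one for a Hermitian matrix `S`). -/
noncomputable def orderedEigenvalues (S : Matrix (Fin m) (Fin m) F) : Fin m → ℝ :=
  if h : ∃ l, IsOrderedEigenvalues S l then h.choose else 0

end Definitions

/-- The multivariate gamma function `Γ_m^β[a] = π^{m(m-1)β/4} ∏_{i=1}^m Γ(a - (i-1)β/2)`. -/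
noncomputable def multivariateGamma (β m : ℕ) (a : ℝ) : ℝ :=
  Real.pi ^ ((m : ℝ) * ((m : ℝ) - 1) * (β : ℝ) / 4) *
    ∏ i : Fin m, Real.Gamma (a - (i : ℝ) * (β : ℝ) / 2)

/-- The exponent `ϱ`, for `β = 1, 2, 4` (no other value of `β` occurs). -/
def varrho (β m : ℕ) : ℝ :=
  if β = 1 then 0 else if β = 2 then -(m : ℝ) else if β = 4 then -2 * (m : ℝ) else 0

/-!
The theorem is Weyl's integration formula for the Hermitian matrices over `F`, with its constant:
for measurable `φ ≥ 0`,
`∫ φ dS = c_m ∫_{l strictly decreasing} ∏_{i < j} (l i - l j) ^ β * ∫ φ (H * diag l * Hᴴ) dH dl`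
(`lintegral_hermitianVolume_eq`). Applied to `φ = f` times the indicator function of the set where
the matrix is positive definite and its eigenvalues lie in a Borel set `B`, it computes the
probability that the eigenvalues lie in `B`.

Conjugation by a unitary matrix preserves the Frobenius norm, hence the measure `dS`
(`measurePreserving_conj`). So `φ` may be replaced by its average over all conjugations, and only
functions `φ` that are invariant under conjugation have to be integrated
(`lintegral_hermitianVolume_of_invariant`). For these there is an induction on the size, which
needs no tangent spaces or coordinates on the unitary group.

* Write an `(n + 1) × (n + 1)` matrix as a corner entry `d`, a border `v` and a block `A`. By
  invariance the integral over `d` and `v` is an invariant function of `A`, so by induction `A`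
  may be taken to be diagonal with entries `a 0 > a 1 > ⋯`, weighted by `∏ (a i - a j) ^ β`.
* The resulting arrowhead matrix has eigenvalues `l` that interlace with `a` and depend only on
  `a`, `d` and the `‖v i‖ ^ 2`. Here `d` is a difference of traces and the `‖v i‖ ^ 2` are, up to
  sign, the residues of `∏ (t - l j) / ∏ (t - a i)`, hence rational functions of `l`
  (`arrowParams`). The eigenvectors are explicit as well (`exists_unitary_borderMat_eq`). The
  Jacobian of the change of variables is a bordered Cauchy determinant (`lintegral_arrowParams`),
  and the law of `‖v i‖ ^ 2` comes from polar coordinates in `F` (`lintegral_pi_norm_sq`).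
* For fixed `l`, what remains to be integrated over `a` is
  `∏ (a i - a j) * ∏ |l j - a i| ^ (β / 2 - 1)` on the set of interlacing `a`. This is the
  Dixon–Anderson integral (`lintegral_dixonAnderson`), again a change of variables with a bordered
  Cauchy determinant as Jacobian. It supplies the missing power of `∏ (l i - l j)` and, with the
  constants in the law of the `‖v i‖ ^ 2`, the factor
  `π ^ (n β / 2) * Γ (β / 2) / Γ ((n + 1) β / 2)` of the constant (`lintegral_interlace`).

The product of these factors is the constant of the theorem because `Γ (β / 2) ^ m` equals
`π ^ (m β / 2 + ϱ)` for `β = 1, 2, 4` (`eigenConst_eq`), and by Frobenius' theorem `β` takes no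
other value (`finrank_eq_one_or_two_or_four`).

Measurability of the eigenvalues does not need any perturbation theory: the integration formula
shows that almost every Hermitian matrix is `H * diag l * Hᴴ` with `l` strictly decreasing, and the
matrices of this form with `l` in a closed set are a continuous image of a `σ`-compact space
(`measurableSet_simpleSpectrumSet`, `measurable_eigenvalueMap`).
-/


/-! ### Cauchy determinants -/

/-- The product `∏_{i < j} (l i - l j)` of differences, positive if `l` is strictly decreasing. -/
noncomputable def vandermondeProd {n : ℕ} (l : Fin n → ℝ) : ℝ :=
  ∏ i : Fin n, ∏ j ∈ Finset.Ioi i, (l i - l j)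

theorem vandermondeProd_succ {n : ℕ} (l : Fin (n + 1) → ℝ) :
    vandermondeProd l =
      (∏ j : Fin n, (l 0 - l j.succ)) * vandermondeProd (fun j : Fin n => l j.succ) := by
  unfold vandermondeProd
  rw [Fin.prod_univ_succ]
  simp only [Fin.Ioi_zero_eq_map, Finset.prod_map, Fin.coe_succEmb, Fin.prod_Ioi_succ]

theorem vandermondeProd_pos {n : ℕ} {l : Fin n → ℝ} (hl : StrictAnti l) :
    0 < vandermondeProd l :=
  Finset.prod_pos fun _ _ => Finset.prod_pos fun _ hj => sub_pos.2 (hl (Finset.mem_Ioi.1 hj))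

theorem continuous_vandermondeProd {n : ℕ} :
    Continuous (vandermondeProd : (Fin n → ℝ) → ℝ) := by
  unfold vandermondeProd
  fun_prop

theorem abs_prod_erase_sub {n : ℕ} (l : Fin n → ℝ) :
    |∏ i, ∏ j ∈ Finset.univ.erase i, (l i - l j)| = vandermondeProd l ^ 2 := by
  have h := Finset.prod_prod_Ioi_mul_eq_prod_prod_off_diag (fun j i : Fin n => |l i - l j|)
  simp only [Finset.abs_prod]
  have e : ∀ i : Fin n, ({i}ᶜ : Finset (Fin n)) = Finset.univ.erase i := fun i => by
    ext; simp
  simp only [e] at h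
  rw [← h, vandermondeProd, ← Finset.prod_pow]
  refine Finset.prod_congr rfl fun i _ => ?_
  rw [← Finset.prod_pow]
  refine Finset.prod_congr rfl fun j _ => ?_
  rw [abs_sub_comm (l j), abs_mul_abs_self, sq]

/-- The Cauchy matrix `1 / (x j - y i)`. -/
noncomputable def cauchyMat {n : ℕ} (x y : Fin n → ℝ) : Matrix (Fin n) (Fin n) ℝ :=
  Matrix.of fun i j => (x j - y i)⁻¹

/-- The Cauchy matrix `1 / (x j - y i)` with an additional first row of ones. -/
noncomputable def borderedCauchyMat {n : ℕ} (x : Fin (n + 1) → ℝ) (y : Fin n → ℝ) :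
    Matrix (Fin (n + 1)) (Fin (n + 1)) ℝ :=
  Matrix.of (Fin.cons (fun _ => 1) fun i j => (x j - y i)⁻¹)

theorem det_borderedCauchyMat_eq {n : ℕ} (x : Fin (n + 1) → ℝ) (y : Fin n → ℝ)
    (h : ∀ i j, x j - y i ≠ 0) :
    (borderedCauchyMat x y).det = (∏ j : Fin n, (x 0 - x j.succ)) * (∏ i, (x 0 - y i)⁻¹) *
      (cauchyMat (fun j => x j.succ) y).det := by
  -- subtract the first column from the others
  have h1 : (borderedCauchyMat x y)ᵀ.det =
      (Matrix.of fun i j : Fin (n + 1) => (borderedCauchyMat x y) j i -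
        (if i = 0 then 0 else 1) * (borderedCauchyMat x y) j 0).det := by
    refine Matrix.det_eq_of_forall_row_eq_smul_add_const (fun i => if i = 0 then 0 else 1) 0
      (by simp) fun i j => ?_
    simp
  rw [← Matrix.det_transpose, h1, ← Matrix.det_transpose, Matrix.det_succ_row_zero,
    Finset.sum_eq_single 0 _ (by simp)]
  · have h2 : ((Matrix.of fun i j : Fin (n + 1) => (borderedCauchyMat x y) j i -
        (if i = 0 then 0 else 1) * (borderedCauchyMat x y) j 0)ᵀ.submatrix Fin.succ
          (Fin.succAbove 0)) = Matrix.of fun i j : Fin n => (x 0 - y i)⁻¹ *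
            (Matrix.of fun i j : Fin n => (x 0 - x j.succ) *
              cauchyMat (fun j => x j.succ) y i j) i j := by
      ext i j
      simp [borderedCauchyMat, cauchyMat]
      field_simp [h i 0, h i j.succ]
      ring
    rw [h2, Matrix.det_mul_column, Matrix.det_mul_row]
    simp [borderedCauchyMat]
    ring
  · intro j _ hj
    simp [borderedCauchyMat, hj]

theorem det_cauchyMat_succ {n : ℕ} (x y : Fin (n + 1) → ℝ) (h : ∀ i j, x j - y i ≠ 0) :
    (cauchyMat x y).det = (∏ i : Fin n, (y i.succ - y 0)) * (∏ j, (x j - y 0)⁻¹) *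
      (borderedCauchyMat x fun i => y i.succ).det := by
  -- subtract the first row from the others
  have h1 : (cauchyMat x y).det =
      (Matrix.of fun i j : Fin (n + 1) => cauchyMat x y i j -
        (if i = 0 then 0 else 1) * cauchyMat x y 0 j).det := by
    refine Matrix.det_eq_of_forall_row_eq_smul_add_const (fun i => if i = 0 then 0 else 1) 0
      (by simp) fun i j => ?_
    simp
  have h2 : (Matrix.of fun i j : Fin (n + 1) => cauchyMat x y i j -
        (if i = 0 then 0 else 1) * cauchyMat x y 0 j) =
      Matrix.of fun i j : Fin (n + 1) => (Fin.cons 1 fun i : Fin n => y i.succ - y 0 :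
          Fin (n + 1) → ℝ) i *
        (Matrix.of fun i j : Fin (n + 1) => (x j - y 0)⁻¹ *
          borderedCauchyMat x (fun i => y i.succ) i j) i j := by
    ext i j
    refine Fin.cases ?_ (fun i => ?_) i
    · simp [borderedCauchyMat, cauchyMat]
    · simp [borderedCauchyMat, cauchyMat]
      field_simp [h 0 j, h i.succ j]
      ring
  rw [h1, h2, Matrix.det_mul_column, Matrix.det_mul_row, Fin.prod_univ_succ]
  simp [mul_assoc]

theorem abs_det_cauchyMat {n : ℕ} (x y : Fin n → ℝ) (h : ∀ i j, x j - y i ≠ 0) :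
    |(cauchyMat x y).det| =
      |vandermondeProd x| * |vandermondeProd y| / ∏ i, ∏ j, |x j - y i| := by
  induction n with
  | zero => simp [vandermondeProd]
  | succ n ih =>
    rw [det_cauchyMat_succ x y h, det_borderedCauchyMat_eq x _ fun i j => h i.succ j,
      abs_mul, abs_mul, abs_mul, abs_mul, ih _ _ fun i j => h i.succ j.succ,
      vandermondeProd_succ x, vandermondeProd_succ y, abs_mul, abs_mul]
    have e : |∏ i : Fin n, (y i.succ - y 0)| = |∏ i : Fin n, (y 0 - y i.succ)| := by
      simp only [Finset.abs_prod, abs_sub_comm (y 0)]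
    have p1 : (∏ i : Fin n, ∏ j : Fin (n + 1), |x j - y i.succ|) =
        (∏ i : Fin n, |x 0 - y i.succ|) * ∏ i : Fin n, ∏ j : Fin n, |x j.succ - y i.succ| := by
      rw [← Finset.prod_mul_distrib]
      exact Finset.prod_congr rfl fun i _ => Fin.prod_univ_succ _
    rw [e, Fin.prod_univ_succ (fun i => ∏ j, |x j - y i|), p1]
    simp only [Finset.abs_prod, abs_inv, Finset.prod_inv_distrib]
    simp only [div_eq_mul_inv, mul_inv]
    ring

theorem abs_det_borderedCauchyMat {n : ℕ} (x : Fin (n + 1) → ℝ) (y : Fin n → ℝ)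
    (h : ∀ i j, x j - y i ≠ 0) :
    |(borderedCauchyMat x y).det| =
      |vandermondeProd x| * |vandermondeProd y| / ∏ i, ∏ j, |x j - y i| := by
  rw [det_borderedCauchyMat_eq x y h, abs_mul, abs_mul,
    abs_det_cauchyMat _ _ fun i j => h i j.succ, vandermondeProd_succ x, abs_mul]
  have p1 : (∏ i : Fin n, ∏ j : Fin (n + 1), |x j - y i|) =
      (∏ i : Fin n, |x 0 - y i|) * ∏ i : Fin n, ∏ j : Fin n, |x j.succ - y i| := by
    rw [← Finset.prod_mul_distrib]
    exact Finset.prod_congr rfl fun i _ => Fin.prod_univ_succ _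
  rw [p1]
  simp only [Finset.abs_prod, abs_inv, Finset.prod_inv_distrib]
  simp only [div_eq_mul_inv, mul_inv]
  ring

/-! ### Interlacing sequences and polynomials -/

/-- The `n` numbers `a` separate the `n + 1` numbers `l`: `l 0 > a 0 > l 1 > ⋯ > a (n-1) > l n`. -/
def Interlace {n : ℕ} (a : Fin n → ℝ) (l : Fin (n + 1) → ℝ) : Prop :=
  ∀ i, a i < l i.castSucc ∧ l i.succ < a i

namespace Interlace

variable {n : ℕ} {a : Fin n → ℝ} {l : Fin (n + 1) → ℝ}

theorem strictAnti_right (h : Interlace a l) : StrictAnti l :=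
  Fin.strictAnti_iff_succ_lt.2 fun i => (h i).2.trans (h i).1

theorem strictAnti_left (h : Interlace a l) : StrictAnti a := by
  cases n with
  | zero => exact fun i => i.elim0
  | succ n =>
    exact Fin.strictAnti_iff_succ_lt.2 fun i => (h i.succ).1.trans (h i.castSucc).2

theorem sub_pos_of_le (h : Interlace a l) {i : Fin n} {j : Fin (n + 1)} (hj : j ≤ i.castSucc) :
    0 < l j - a i :=
  sub_pos.2 ((h i).1.trans_le (h.strictAnti_right.antitone hj))

theorem sub_neg_of_lt (h : Interlace a l) {i : Fin n} {j : Fin (n + 1)} (hj : i.castSucc < j) :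
    l j - a i < 0 :=
  sub_neg.2 ((h.strictAnti_right.antitone (Fin.castSucc_lt_iff_succ_le.1 hj)).trans_lt (h i).2)

theorem sub_ne_zero (h : Interlace a l) (i : Fin n) (j : Fin (n + 1)) : l j - a i ≠ 0 := by
  rcases le_or_gt j i.castSucc with hj | hj
  · exact (h.sub_pos_of_le hj).ne'
  · exact (h.sub_neg_of_lt hj).ne

end Interlace

theorem isOpen_setOf_interlace {n : ℕ} :
    IsOpen {p : (Fin n → ℝ) × (Fin (n + 1) → ℝ) | Interlace p.1 p.2} := by
  simp only [Interlace, Set.ofPred_forall, Set.ofPred_and]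
  refine isOpen_iInter_of_finite fun i => IsOpen.inter ?_ ?_
  · exact isOpen_lt (by fun_prop) (by fun_prop)
  · exact isOpen_lt (by fun_prop) (by fun_prop)

theorem neg_one_pow_mul_prod_sub_pos {n : ℕ} {x : Fin n → ℝ} {t : ℝ} {k : ℕ} (hk : k ≤ n)
    (h1 : ∀ i : Fin n, (i : ℕ) < k → t < x i) (h2 : ∀ i : Fin n, k ≤ (i : ℕ) → x i < t) :
    0 < (-1) ^ k * ∏ i, (t - x i) := by
  have e : ((-1 : ℝ)) ^ k = ∏ i : Fin n, if (i : ℕ) < k then -1 else 1 := by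
    rw [Finset.prod_ite, Finset.prod_const, Finset.prod_const_one, mul_one]
    congr 1
    have : (Finset.univ.filter fun i : Fin n => (i : ℕ) < k).card = min n k := by
      simp [Fin.card_filter_val_lt]
    omega
  rw [e, ← Finset.prod_mul_distrib]
  refine Finset.prod_pos fun i _ => ?_
  split_ifs with h
  · linarith [h1 i h]
  · linarith [h2 i (not_lt.1 h)]

/-- For a strictly decreasing sequence, the sign of `∏_{j ≠ i} (l i - l j)` is `(-1) ^ i`. -/
theorem neg_one_pow_mul_prod_erase_pos {n : ℕ} {l : Fin n → ℝ} (hl : StrictAnti l) (i : Fin n) :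
    0 < (-1) ^ (i : ℕ) * ∏ j ∈ Finset.univ.erase i, (l i - l j) := by
  have e : ((-1 : ℝ)) ^ (i : ℕ) = ∏ j ∈ Finset.univ.erase i, if j < i then -1 else 1 := by
    rw [Finset.prod_ite, Finset.prod_const, Finset.prod_const_one, mul_one]
    congr 1
    have : ((Finset.univ.erase i).filter fun j : Fin n => j < i) = Finset.Iio i := by
      ext j
      simp only [Finset.mem_filter, Finset.mem_erase, Finset.mem_univ, Finset.mem_Iio]
      exact ⟨fun h => h.2, fun h => ⟨⟨h.ne, trivial⟩, h⟩⟩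
    rw [this, Fin.card_Iio]
  rw [e, ← Finset.prod_mul_distrib]
  refine Finset.prod_pos fun j hj => ?_
  split_ifs with h
  · linarith [hl h]
  · linarith [hl (lt_of_le_of_ne (not_lt.1 h) (Finset.ne_of_mem_erase hj).symm)]

open Polynomial in
/-- A real polynomial of degree at most `N` whose signs alternate at `N + 1` points splits, with
one root in each of the gaps. -/
theorem exists_roots_of_alternating {N : ℕ} (P : ℝ[X]) (hP : P.natDegree ≤ N)
    {x : Fin (N + 1) → ℝ} (hx : StrictAnti x)
    (hs : ∀ i : Fin (N + 1), 0 < (-1) ^ (i : ℕ) * P.eval (x i)) :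
    ∃ y : Fin N → ℝ, Interlace y x ∧ P = C (P.coeff N) * ∏ i, (X - C (y i)) := by
  have hroot : ∀ i : Fin N, ∃ t, (t < x i.castSucc ∧ x i.succ < t) ∧ P.eval t = 0 := by
    intro i
    have hc : ContinuousOn (fun t => (-1) ^ (i : ℕ) * P.eval t)
        (Set.Icc (x i.succ) (x i.castSucc)) := by fun_prop
    have h1 := hs i.castSucc
    have h2 := hs i.succ
    rw [Fin.val_castSucc] at h1
    rw [Fin.val_succ, pow_succ] at h2
    obtain ⟨t, ht, ht0⟩ := intermediate_value_Ioo (hx Fin.castSucc_lt_succ).le hc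
      (show (0 : ℝ) ∈ Set.Ioo _ _ from ⟨by linarith, h1⟩)
    exact ⟨t, ⟨ht.2, ht.1⟩, (mul_eq_zero.1 ht0).resolve_left (by simp)⟩
  choose y hy hy0 using hroot
  have hI : Interlace y x := hy
  refine ⟨y, hI, ?_⟩
  have hmon : (∏ i, (X - C (y i))).natDegree = N := by
    rw [natDegree_prod_of_monic _ _ fun i _ => monic_X_sub_C _]; simp
  have hlead : (∏ i, (X - C (y i))).coeff N = 1 := by
    have := (monic_prod_of_monic Finset.univ (fun i => X - C (y i)) fun i _ => monic_X_sub_C _)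
    rw [Monic, leadingCoeff, hmon] at this
    exact this
  refine eq_of_degree_sub_lt_of_eval_index_eq Finset.univ (v := y)
    hI.strictAnti_left.injective.injOn ?_ fun i _ => ?_
  · rw [Finset.card_univ, Fintype.card_fin, degree_lt_iff_coeff_zero]
    intro m hm
    rcases hm.eq_or_lt with rfl | hm
    · rw [coeff_sub, coeff_C_mul, hlead]; ring
    · rw [coeff_sub, coeff_C_mul, coeff_eq_zero_of_natDegree_lt (hP.trans_lt hm),
        coeff_eq_zero_of_natDegree_lt (hmon.trans_lt hm)]; ring
  · rw [hy0, eval_mul, eval_prod, Finset.prod_eq_zero (Finset.mem_univ i) (by simp), mul_zero]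

/-! ### The secular equation of an arrowhead matrix -/

section Secular

open Polynomial

variable {n : ℕ}

theorem eq_of_prod_X_sub_C_eq {y z : Fin n → ℝ} (hy : StrictAnti y) (hz : StrictAnti z)
    (h : ∏ i, (X - C (y i)) = ∏ i, (X - C (z i))) : y = z := by
  refine (hy.range_inj hz).1 (Set.ext fun t => ?_)
  have h' := congrArg (eval t) h
  simp only [eval_prod, eval_sub, eval_X, eval_C] at h'
  have e : ∀ w : Fin n → ℝ, t ∈ Set.range w ↔ ∏ i, (t - w i) = 0 := fun w => by
    rw [Finset.prod_eq_zero_iff]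
    simp only [Set.mem_range, sub_eq_zero, Finset.mem_univ, true_and, eq_comm]
  rw [e, e, h']

theorem natDegree_prod_X_sub_C (y : Fin n → ℝ) : (∏ i, (X - C (y i))).natDegree = n := by
  rw [natDegree_prod_of_monic _ _ fun i _ => monic_X_sub_C _]; simp

theorem coeff_prod_X_sub_C (y : Fin n → ℝ) : (∏ i, (X - C (y i))).coeff n = 1 := by
  have := (monic_prod_of_monic Finset.univ (fun i => X - C (y i)) fun i _ => monic_X_sub_C _)
  rwa [Monic, leadingCoeff, natDegree_prod_X_sub_C] at this

/-- The characteristic polynomial of the arrowhead matrix with corner `c 0`, remaining diagonal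
entries `a i`, and off-diagonal entries of squared modulus `c (i + 1)`. -/
noncomputable def secularPoly (a : Fin n → ℝ) (c : Fin (n + 1) → ℝ) : ℝ[X] :=
  (X - C (c 0)) * ∏ i, (X - C (a i)) -
    ∑ i : Fin n, C (c i.succ) * ∏ k ∈ Finset.univ.erase i, (X - C (a k))

theorem coeff_secularPoly_sum (a : Fin n → ℝ) (c : Fin (n + 1) → ℝ) {m : ℕ} (hm : n ≤ m) :
    (∑ i : Fin n, C (c i.succ) * ∏ k ∈ Finset.univ.erase i, (X - C (a k))).coeff m = 0 := by
  rw [finsetSum_coeff]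
  refine Finset.sum_eq_zero fun i _ => ?_
  rw [coeff_C_mul, coeff_eq_zero_of_natDegree_lt, mul_zero]
  rw [natDegree_prod_of_monic _ _ fun i _ => monic_X_sub_C _]
  simp only [natDegree_X_sub_C, Finset.sum_const, smul_eq_mul, mul_one,
    Finset.card_erase_of_mem (Finset.mem_univ i), Finset.card_univ, Fintype.card_fin]
  have := i.pos
  omega

theorem coeff_secularPoly (a : Fin n → ℝ) (c : Fin (n + 1) → ℝ) {m : ℕ} (hm : n ≤ m) :
    (secularPoly a c).coeff m =
      (∏ i, (X - C ((Fin.cons (c 0) a : Fin (n + 1) → ℝ) i))).coeff m := by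
  rw [secularPoly, coeff_sub, coeff_secularPoly_sum a c hm, sub_zero, Fin.prod_univ_succ]
  simp

theorem natDegree_secularPoly_le (a : Fin n → ℝ) (c : Fin (n + 1) → ℝ) :
    (secularPoly a c).natDegree ≤ n + 1 := by
  rw [natDegree_le_iff_coeff_eq_zero]
  intro m hm
  rw [coeff_secularPoly a c (by omega), coeff_eq_zero_of_natDegree_lt]
  rwa [natDegree_prod_X_sub_C]

theorem coeff_secularPoly_top (a : Fin n → ℝ) (c : Fin (n + 1) → ℝ) :
    (secularPoly a c).coeff (n + 1) = 1 := by
  rw [coeff_secularPoly a c (by omega), coeff_prod_X_sub_C]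

theorem eval_secularPoly_self (a : Fin n → ℝ) (c : Fin (n + 1) → ℝ) (i : Fin n) :
    (secularPoly a c).eval (a i) = -(c i.succ * ∏ k ∈ Finset.univ.erase i, (a i - a k)) := by
  simp only [secularPoly, eval_sub, eval_mul, eval_prod, eval_finsetSum, eval_X, eval_C]
  rw [Finset.prod_eq_zero (Finset.mem_univ i) (sub_self _), mul_zero, zero_sub,
    Finset.sum_eq_single i _ (by simp)]
  intro j _ hj
  rw [Finset.prod_eq_zero (Finset.mem_erase.2 ⟨hj.symm, Finset.mem_univ i⟩) (sub_self _), mul_zero]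

theorem prod_erase_sub_ne_zero {a : Fin n → ℝ} (ha : Function.Injective a) (i : Fin n) :
    ∏ k ∈ Finset.univ.erase i, (a i - a k) ≠ 0 :=
  Finset.prod_ne_zero_iff.2 fun _ hk =>
    sub_ne_zero.2 fun h => Finset.ne_of_mem_erase hk (ha h).symm

theorem secularPoly_injective {a : Fin n → ℝ} (ha : Function.Injective a) :
    Function.Injective (secularPoly a) := by
  intro c c' h
  have h1 : ∀ i : Fin n, c i.succ = c' i.succ := by
    intro i
    have := congrArg (eval (a i)) h
    rw [eval_secularPoly_self, eval_secularPoly_self, neg_inj] at this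
    exact mul_right_cancel₀ (prod_erase_sub_ne_zero ha i) this
  have h0 : c 0 = c' 0 := by
    simp only [secularPoly, h1] at h
    have h2 := mul_right_cancel₀ (monic_prod_of_monic Finset.univ (fun i => X - C (a i))
      fun i _ => monic_X_sub_C _).ne_zero (sub_left_inj.1 h)
    exact C_injective (sub_right_inj.1 h2)
  exact funext fun i => Fin.cases h0 h1 i

/-- The parameters (corner entry, squared moduli of the border) of an arrowhead matrix with
diagonal entries `a` and eigenvalues `l`. -/
noncomputable def arrowParams (a : Fin n → ℝ) (l : Fin (n + 1) → ℝ) : Fin (n + 1) → ℝ :=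
  Fin.cons (∑ j, l j - ∑ i, a i) fun i =>
    -(∏ j, (a i - l j)) / ∏ k ∈ Finset.univ.erase i, (a i - a k)

/-- Both sides are monic with the same second coefficient, and they agree at the `a i`. -/
theorem secularPoly_arrowParams {a : Fin n → ℝ} (ha : Function.Injective a)
    (l : Fin (n + 1) → ℝ) : secularPoly a (arrowParams a l) = ∏ j, (X - C (l j)) := by
  have hcard : ((Finset.univ : Finset (Fin (n + 1))).card) = n + 1 := by simp
  refine eq_of_degree_sub_lt_of_eval_index_eq Finset.univ (v := a) ha.injOn ?_ fun i _ => ?_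
  · rw [Finset.card_univ, Fintype.card_fin, degree_lt_iff_coeff_zero]
    intro m hm
    rw [coeff_sub, coeff_secularPoly _ _ hm, sub_eq_zero]
    rcases hm.eq_or_lt with rfl | hm
    · have h := fun y : Fin (n + 1) → ℝ => prod_X_sub_C_coeff_card_pred Finset.univ y (by simp)
      simp only [hcard, Nat.add_sub_cancel] at h
      rw [h, h, Fin.sum_univ_succ]
      simp [arrowParams]
    · rcases (Nat.succ_le_of_lt hm).eq_or_lt with rfl | hm
      · rw [coeff_prod_X_sub_C, coeff_prod_X_sub_C]
      · rw [coeff_eq_zero_of_natDegree_lt, coeff_eq_zero_of_natDegree_lt] <;>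
          rwa [natDegree_prod_X_sub_C]
  · rw [eval_secularPoly_self, eval_prod, arrowParams, Fin.cons_succ,
      div_mul_cancel₀ _ (prod_erase_sub_ne_zero ha i), neg_neg]
    simp

theorem arrowParams_injOn {a : Fin n → ℝ} (ha : Function.Injective a) :
    Set.InjOn (arrowParams a) {l | Interlace a l} := by
  intro l hl l' hl' h
  refine eq_of_prod_X_sub_C_eq hl.strictAnti_right hl'.strictAnti_right ?_
  rw [← secularPoly_arrowParams ha, ← secularPoly_arrowParams ha, h]

theorem arrowParams_succ_pos {a : Fin n → ℝ} {l : Fin (n + 1) → ℝ} (h : Interlace a l)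
    (i : Fin n) : 0 < arrowParams a l i.succ := by
  rw [arrowParams, Fin.cons_succ]
  have h1 := neg_one_pow_mul_prod_erase_pos h.strictAnti_left i
  have h2 : 0 < (-1) ^ ((i : ℕ) + 1) * ∏ j, (a i - l j) := by
    refine neg_one_pow_mul_prod_sub_pos (by omega) (fun j hj => ?_) fun j hj => ?_
    · exact sub_pos.1 (h.sub_pos_of_le (Fin.le_def.2 (by simpa using Nat.lt_succ_iff.1 hj)))
    · exact sub_neg.1 (h.sub_neg_of_lt (Fin.lt_def.2 (by simpa using Nat.lt_of_succ_le hj)))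
  rw [pow_succ] at h2
  have := div_pos h2 h1
  rw [mul_assoc, mul_div_mul_left _ _ (by simp)] at this
  simpa using this

/-- The secular equation has one root above the diagonal entries, one in each of their gaps, and
one below. -/
theorem exists_interlace_arrowParams_eq {a : Fin n → ℝ} (ha : StrictAnti a)
    {c : Fin (n + 1) → ℝ} (hc : ∀ i : Fin n, 0 < c i.succ) :
    ∃ l, Interlace a l ∧ arrowParams a l = c := by
  set P := secularPoly a c with hP
  have hdeg : P.natDegree = n + 1 := le_antisymm (natDegree_secularPoly_le a c)
    (le_natDegree_of_ne_zero (by rw [coeff_secularPoly_top]; exact one_ne_zero))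
  have hlead : P.leadingCoeff = 1 := by rw [leadingCoeff, hdeg, coeff_secularPoly_top]
  have hX : (-X : ℝ[X]).natDegree = 1 := by simp
  set Q := C ((-1) ^ (n + 1)) * P.comp (-X) with hQ
  have hQdeg : Q.natDegree = n + 1 := by
    rw [hQ, natDegree_C_mul (by simp), natDegree_comp, hX, hdeg, mul_one]
  have hQlead : Q.leadingCoeff = 1 := by
    rw [hQ, leadingCoeff_C_mul_of_isUnit (by simp), leadingCoeff_comp (by simp), hdeg, hlead]
    simp [← mul_pow]
  have tP := P.tendsto_atTop_of_leadingCoeff_nonneg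
    (natDegree_pos_iff_degree_pos.1 (by omega)) (by rw [hlead]; exact zero_le_one)
  have tQ := Q.tendsto_atTop_of_leadingCoeff_nonneg
    (natDegree_pos_iff_degree_pos.1 (by omega)) (by rw [hQlead]; exact zero_le_one)
  obtain ⟨M, hM1, hM2, hM3, hM4⟩ := ((tP.eventually_gt_atTop 0).and
    ((tQ.eventually_gt_atTop 0).and ((Filter.eventually_gt_atTop (∑ i, |a i|)).and
      (Filter.eventually_gt_atTop 0)))).exists
  have hMa : ∀ i, |a i| < M := fun i =>
    (Finset.single_le_sum (fun i _ => abs_nonneg (a i)) (Finset.mem_univ i)).trans_lt hM3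
  -- the signs of the secular polynomial alternate along `M > a 0 > ⋯ > a (n - 1) > -M`
  set x : Fin (n + 2) → ℝ := Fin.cons M (Fin.snoc a (-M)) with hx
  have hx0 : x 0 = M := rfl
  have hxa : ∀ i : Fin n, x i.castSucc.succ = a i := fun i => by simp [hx]
  have hxl : x (Fin.last (n + 1)) = -M := by
    rw [hx, ← Fin.succ_last, Fin.cons_succ, Fin.snoc_last]
  have hxanti : StrictAnti x := by
    refine Fin.strictAnti_iff_succ_lt.2 fun i => ?_
    refine Fin.lastCases ?_ (fun i => ?_) i
    · rw [Fin.succ_last, hxl]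
      rcases n with _ | n
      · change -M < M
        linarith
      · rw [← Fin.succ_last n, ← Fin.succ_castSucc, hxa]
        exact (abs_lt.1 (hMa _)).1
    · rw [hxa]
      rcases n with _ | n
      · exact i.elim0
      · refine Fin.cases ?_ (fun i => ?_) i
        · change a 0 < M
          exact (abs_lt.1 (hMa _)).2
        · change a i.succ < x i.castSucc.castSucc.succ
          rw [hxa]
          exact ha Fin.castSucc_lt_succ
  have hsign : ∀ i : Fin (n + 2), 0 < (-1) ^ (i : ℕ) * P.eval (x i) := by
    intro i
    refine Fin.cases ?_ (fun i => ?_) i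
    · simpa [hx0] using hM1
    · refine Fin.lastCases ?_ (fun i => ?_) i
      · rw [Fin.succ_last, hxl]
        simpa [hQ] using hM2
      · rw [hxa, hP, eval_secularPoly_self]
        have := mul_pos (neg_one_pow_mul_prod_erase_pos ha i) (hc i)
        simp only [Fin.val_succ, Fin.val_castSucc, pow_succ]
        linarith
  obtain ⟨l, hl, hPl⟩ := exists_roots_of_alternating P hdeg.le hxanti hsign
  have hI : Interlace a l := by
    intro i
    have h1 := (hl i.castSucc).2
    have h2 := (hl i.succ).1
    rw [hxa] at h1
    rw [← Fin.succ_castSucc, hxa] at h2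
    exact ⟨h1, h2⟩
  refine ⟨l, hI, secularPoly_injective ha.injective ?_⟩
  rw [secularPoly_arrowParams ha.injective, ← hP, hPl, hP, coeff_secularPoly_top, C_1, one_mul]

theorem image_arrowParams {a : Fin n → ℝ} (ha : StrictAnti a) :
    arrowParams a '' {l | Interlace a l} = {c | ∀ i : Fin n, 0 < c i.succ} := by
  ext c
  constructor
  · rintro ⟨l, hl, rfl⟩
    exact arrowParams_succ_pos hl
  · intro hc
    obtain ⟨l, hl, rfl⟩ := exists_interlace_arrowParams_eq ha hc
    exact ⟨l, hl, rfl⟩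

theorem abs_prod_arrowParams {a : Fin n → ℝ} {l : Fin (n + 1) → ℝ} :
    |∏ i : Fin n, arrowParams a l i.succ| =
      (∏ i, ∏ j, |l j - a i|) / vandermondeProd a ^ 2 := by
  simp only [arrowParams, Fin.cons_succ]
  rw [Finset.prod_div_distrib, abs_div, abs_prod_erase_sub]
  simp only [Finset.abs_prod, abs_neg, abs_sub_comm (l _)]

theorem hasFDerivAt_arrowParams {a : Fin n → ℝ} {l : Fin (n + 1) → ℝ} (h : Interlace a l) :
    HasFDerivAt (arrowParams a) (Matrix.toLin' (Matrix.of fun i j =>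
      (Fin.cons 1 fun i : Fin n => arrowParams a l i.succ : Fin (n + 1) → ℝ) i *
        borderedCauchyMat l a i j)).toContinuousLinearMap l := by
  rw [hasFDerivAt_pi']
  refine Fin.cases ?_ fun i => ?_
  · have h1 : HasFDerivAt (fun x : Fin (n + 1) → ℝ => ∑ j, x j - ∑ i, a i)
        (∑ j, ContinuousLinearMap.proj (R := ℝ) (φ := fun _ : Fin (n + 1) => ℝ) j) l :=
      HasFDerivAt.sub_const _ (HasFDerivAt.fun_sum fun j _ => hasFDerivAt_apply j l)
    refine h1.congr_fderiv ?_
    ext v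
    simp [borderedCauchyMat, Matrix.mulVec, dotProduct]
  · have h1 : HasFDerivAt (fun x : Fin (n + 1) → ℝ => ∏ j, (a i - x j))
        (∑ j, (∏ k ∈ Finset.univ.erase j, (a i - l k)) •
          -ContinuousLinearMap.proj (R := ℝ) (φ := fun _ : Fin (n + 1) => ℝ) j) l :=
      HasFDerivAt.finsetProd fun j _ => (hasFDerivAt_apply j l).const_sub _
    have h2 := h1.neg.mul_const (∏ k ∈ Finset.univ.erase i, (a i - a k))⁻¹
    refine h2.congr_fderiv ?_
    ext v
    simp only [borderedCauchyMat, arrowParams, div_eq_mul_inv]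
    simp [Matrix.mulVec, dotProduct, Finset.mul_sum]
    rw [← Finset.sum_neg_distrib]
    refine Finset.sum_congr rfl fun j _ => ?_
    rw [← Finset.mul_prod_erase Finset.univ (fun k => a i - l k) (Finset.mem_univ j)]
    have := h.sub_ne_zero i j
    field_simp
    ring

theorem abs_det_fderiv_arrowParams {a : Fin n → ℝ} {l : Fin (n + 1) → ℝ} (h : Interlace a l) :
    |(Matrix.toLin' (Matrix.of fun i j =>
      (Fin.cons 1 fun i : Fin n => arrowParams a l i.succ : Fin (n + 1) → ℝ) i *
        borderedCauchyMat l a i j)).toContinuousLinearMap.det| =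
      vandermondeProd l / vandermondeProd a := by
  rw [LinearMap.det_toContinuousLinearMap, LinearMap.det_toLin', Matrix.det_mul_column,
    Fin.prod_univ_succ, abs_mul, abs_det_borderedCauchyMat _ _ h.sub_ne_zero]
  simp only [Fin.cons_zero, Fin.cons_succ, one_mul]
  rw [abs_prod_arrowParams, abs_of_pos (vandermondeProd_pos h.strictAnti_right),
    abs_of_pos (vandermondeProd_pos h.strictAnti_left)]
  have h1 := (vandermondeProd_pos h.strictAnti_left).ne'
  have h2 : (∏ i, ∏ j, |l j - a i|) ≠ 0 := Finset.prod_ne_zero_iff.2 fun i _ =>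
    Finset.prod_ne_zero_iff.2 fun j _ => abs_ne_zero.2 (h.sub_ne_zero i j)
  field_simp

/-- The change of variables from the parameters of an arrowhead matrix to its eigenvalues. -/
theorem lintegral_arrowParams {a : Fin n → ℝ} (ha : StrictAnti a)
    (g : (Fin (n + 1) → ℝ) → ENNReal) :
    ∫⁻ c in {c | ∀ i : Fin n, 0 < c i.succ}, g c = ∫⁻ l in {l | Interlace a l},
      ENNReal.ofReal (vandermondeProd l / vandermondeProd a) * g (arrowParams a l) := by
  have hm : MeasurableSet {l | Interlace a l} :=
    (isOpen_setOf_interlace.preimage (Continuous.prodMk_right a)).measurableSet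
  rw [← image_arrowParams ha, lintegral_image_eq_lintegral_abs_det_fderiv_mul volume hm
    (fun l hl => (hasFDerivAt_arrowParams hl).hasFDerivWithinAt)
    (arrowParams_injOn ha.injective)]
  exact setLIntegral_congr_fun hm fun l hl => by rw [abs_det_fderiv_arrowParams hl]

end Secular

/-! ### Integrals over product spaces -/

theorem lintegral_pi_fin_succ {α : Type*} [MeasurableSpace α] (μ : Measure α) [SigmaFinite μ]
    {n : ℕ} {f : (Fin (n + 1) → α) → ENNReal} (hf : Measurable f) :
    ∫⁻ x, f x ∂Measure.pi (fun _ => μ) =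
      ∫⁻ t, ∫⁻ y, f (Fin.cons t y) ∂Measure.pi (fun _ : Fin n => μ) ∂μ := by
  have h := (measurePreserving_piFinSuccAbove (fun _ : Fin (n + 1) => μ) 0).symm
  rw [← h.lintegral_comp hf, lintegral_prod
    (fun z => f ((MeasurableEquiv.piFinSuccAbove (fun _ => α) 0).symm z))
    (hf.comp h.measurable).aemeasurable]
  simp [MeasurableEquiv.piFinSuccAbove, Fin.insertNthEquiv]

theorem lintegral_pi_prod {α : Type*} [MeasurableSpace α] (μ : Measure α) [SigmaFinite μ]
    {n : ℕ} {f : Fin n → α → ENNReal} (hf : ∀ i, Measurable (f i)) :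
    ∫⁻ x, ∏ i, f i (x i) ∂Measure.pi (fun _ => μ) = ∏ i, ∫⁻ t, f i t ∂μ := by
  induction n with
  | zero => simp
  | succ n ih =>
    rw [lintegral_pi_fin_succ μ (by fun_prop), Fin.prod_univ_succ]
    simp only [Fin.prod_univ_succ, Fin.cons_zero, Fin.cons_succ]
    simp_rw [lintegral_const_mul _ (show Measurable fun y : Fin n → α => ∏ i, f i.succ (y i) by
      fun_prop), ih fun i => hf i.succ]
    rw [lintegral_mul_const _ (hf 0)]

theorem pi_withDensity {α : Type*} [MeasurableSpace α] (μ : Measure α) [SigmaFinite μ]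
    {n : ℕ} {w : α → ENNReal} (hw : Measurable w) [SigmaFinite (μ.withDensity w)] :
    Measure.pi (fun _ : Fin n => μ.withDensity w) =
      (Measure.pi fun _ : Fin n => μ).withDensity fun x => ∏ i, w (x i) := by
  refine Measure.pi_eq fun s hs => ?_
  rw [withDensity_apply _ (MeasurableSet.univ_pi hs), ← lintegral_indicator
    (MeasurableSet.univ_pi hs)]
  simp only [withDensity_apply _ (hs _), ← lintegral_indicator (hs _)]
  rw [← lintegral_pi_prod μ fun i => hw.indicator (hs i)]
  refine lintegral_congr fun x => ?_
  by_cases hx : x ∈ Set.univ.pi s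
  · rw [Set.indicator_of_mem hx]
    exact Finset.prod_congr rfl fun i _ => (Set.indicator_of_mem (hx i trivial) _).symm
  · rw [Set.indicator_of_notMem hx]
    obtain ⟨i, hi⟩ := not_forall.1 fun h => hx fun i _ => h i
    exact (Finset.prod_eq_zero (Finset.mem_univ i) (Set.indicator_of_notMem hi _)).symm

theorem lintegral_rpow_mul_exp_neg {s : ℝ} (hs : 0 < s) :
    ∫⁻ t in Set.Ioi (0 : ℝ), ENNReal.ofReal (t ^ (s - 1) * Real.exp (-t)) =
      ENNReal.ofReal (Real.Gamma s) := by
  rw [Real.Gamma_eq_integral hs, ofReal_integral_eq_lintegral_ofReal]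
  · exact lintegral_congr fun t => by rw [mul_comm]
  · exact Real.GammaIntegral_convergent hs
  · exact (ae_restrict_mem measurableSet_Ioi).mono fun t ht =>
      mul_nonneg (Real.exp_pos _).le (Real.rpow_nonneg (le_of_lt ht) _)

/-! ### The Dixon–Anderson integral -/

section DixonAnderson

open Polynomial

variable {n : ℕ}

/-- The residues at the points `l j` of the rational function
`x 0 * ∏ i, (t - x (i + 1)) / ∏ j, (t - l j)`. -/
noncomputable def residueParams (l x : Fin (n + 1) → ℝ) : Fin (n + 1) → ℝ := fun j =>
  x 0 * (∏ i : Fin n, (l j - x i.succ)) / ∏ k ∈ Finset.univ.erase j, (l j - l k)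

theorem residueParams_pos {l x : Fin (n + 1) → ℝ} (hx : 0 < x 0)
    (h : Interlace (fun i => x i.succ) l) (j : Fin (n + 1)) : 0 < residueParams l x j := by
  have h1 := neg_one_pow_mul_prod_erase_pos h.strictAnti_right j
  have h2 : 0 < (-1) ^ (j : ℕ) * ∏ i : Fin n, (l j - x i.succ) := by
    refine neg_one_pow_mul_prod_sub_pos (Nat.lt_succ_iff.1 j.2) (fun i hi => ?_) fun i hi => ?_
    · exact sub_neg.1 (h.sub_neg_of_lt (Fin.lt_def.2 hi))
    · exact sub_pos.1 (h.sub_pos_of_le (Fin.le_def.2 hi))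
  have := mul_pos hx (div_pos h2 h1)
  rw [mul_div_mul_left _ _ (by simp), ← mul_div_assoc] at this
  exact this

theorem eval_mul_prod_eq_residueParams {l : Fin (n + 1) → ℝ} (hl : Function.Injective l)
    (x : Fin (n + 1) → ℝ) (j : Fin (n + 1)) :
    (C (x 0) * ∏ i : Fin n, (X - C (x i.succ))).eval (l j) =
      residueParams l x j * ∏ k ∈ Finset.univ.erase j, (l j - l k) := by
  rw [residueParams, div_mul_cancel₀ _ (prod_erase_sub_ne_zero hl j)]
  simp [eval_prod]

theorem degree_mul_prod_X_sub_C_lt (t : ℝ) (y : Fin n → ℝ) :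
    (C t * ∏ i : Fin n, (X - C (y i))).degree < (n + 1 : ℕ) := by
  rw [degree_lt_iff_coeff_zero]
  intro m hm
  rw [coeff_C_mul, coeff_eq_zero_of_natDegree_lt, mul_zero]
  rw [natDegree_prod_X_sub_C]
  omega

/-- The sum of the residues is the leading coefficient of the numerator. -/
theorem sum_residueParams {l : Fin (n + 1) → ℝ} (hl : Function.Injective l)
    (x : Fin (n + 1) → ℝ) : ∑ j, residueParams l x j = x 0 := by
  have h := Lagrange.coeff_eq_sum (s := Finset.univ) (v := l) hl.injOn
    (P := C (x 0) * ∏ i : Fin n, (X - C (x i.succ)))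
    (by simpa using degree_mul_prod_X_sub_C_lt (x 0) fun i => x i.succ)
  rw [Finset.card_univ, Fintype.card_fin, Nat.add_sub_cancel, coeff_C_mul, coeff_prod_X_sub_C,
    mul_one] at h
  rw [h]
  refine Finset.sum_congr rfl fun j _ => ?_
  rw [eval_mul_prod_eq_residueParams hl, mul_div_cancel_right₀ _ (prod_erase_sub_ne_zero hl j)]

theorem residueParams_injOn {l : Fin (n + 1) → ℝ} (hl : Function.Injective l) :
    Set.InjOn (residueParams l) {x | 0 < x 0 ∧ Interlace (fun i => x i.succ) l} := by
  intro x hx x' hx' h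
  have h0 : x 0 = x' 0 := by
    rw [← sum_residueParams hl x, h, sum_residueParams hl]
  have hP : C (x 0) * ∏ i : Fin n, (X - C (x i.succ)) =
      C (x' 0) * ∏ i : Fin n, (X - C (x' i.succ)) := by
    refine eq_of_degrees_lt_of_eval_index_eq Finset.univ (v := l) hl.injOn ?_ ?_ fun j _ => ?_
    · simpa using degree_mul_prod_X_sub_C_lt (x 0) fun i => x i.succ
    · simpa using degree_mul_prod_X_sub_C_lt (x' 0) fun i => x' i.succ
    · rw [eval_mul_prod_eq_residueParams hl, eval_mul_prod_eq_residueParams hl, h]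
  rw [← h0] at hP
  have h1 := eq_of_prod_X_sub_C_eq hx.2.strictAnti_left hx'.2.strictAnti_left
    (mul_left_cancel₀ (C_ne_zero.2 hx.1.ne') hP)
  exact funext fun i => Fin.cases h0 (congrFun h1) i

/-- A rational function with simple poles `l j` and positive residues has a numerator whose signs
alternate at the poles. -/
theorem image_residueParams {l : Fin (n + 1) → ℝ} (hl : StrictAnti l) :
    residueParams l '' {x | 0 < x 0 ∧ Interlace (fun i => x i.succ) l} =
      Set.univ.pi fun _ => Set.Ioi 0 := by
  ext r
  constructor
  · rintro ⟨x, hx, rfl⟩ j -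
    exact residueParams_pos hx.1 hx.2 j
  · intro hr
    set Q : ℝ[X] := ∑ j, C (r j) * ∏ k ∈ Finset.univ.erase j, (X - C (l k)) with hQ
    have hdeg : Q.natDegree ≤ n := by
      refine natDegree_sum_le_of_forall_le _ _ fun j _ => (natDegree_C_mul_le _ _).trans ?_
      rw [natDegree_prod_of_monic _ _ fun i _ => monic_X_sub_C _]
      simp
    have heval : ∀ j, Q.eval (l j) = r j * ∏ k ∈ Finset.univ.erase j, (l j - l k) := by
      intro j
      simp only [hQ, eval_mul, eval_prod, eval_finsetSum, eval_sub, eval_X, eval_C]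
      refine Finset.sum_eq_single j (fun i _ hi => ?_) (by simp)
      rw [Finset.prod_eq_zero (Finset.mem_erase.2 ⟨hi.symm, Finset.mem_univ j⟩) (sub_self _),
        mul_zero]
    obtain ⟨a, ha, hQa⟩ := exists_roots_of_alternating Q hdeg hl fun j => by
      rw [heval]
      have := mul_pos (neg_one_pow_mul_prod_erase_pos hl j) (hr j trivial)
      linarith
    have e : ∀ j, Q.coeff n * ∏ i, (l j - a i) = r j * ∏ k ∈ Finset.univ.erase j, (l j - l k) := by
      intro j
      rw [← heval, hQa]
      simp [eval_prod, coeff_prod_X_sub_C]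
    refine ⟨Fin.cons (Q.coeff n) a, ⟨?_, ?_⟩, ?_⟩
    · have h0 := e 0
      have h1 : 0 < ∏ i, (l 0 - a i) :=
        Finset.prod_pos fun i _ => ha.sub_pos_of_le (Fin.zero_le _)
      have h2 := neg_one_pow_mul_prod_erase_pos hl 0
      rw [Fin.val_zero, pow_zero, one_mul] at h2
      have h3 := mul_pos (hr 0 trivial) h2
      rw [← h0] at h3
      exact pos_of_mul_pos_left h3 h1.le
    · simpa using ha
    · ext j
      simp only [residueParams, Fin.cons_zero, Fin.cons_succ]
      rw [e, mul_div_cancel_right₀ _ (prod_erase_sub_ne_zero hl.injective j)]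

theorem prod_residueParams {l x : Fin (n + 1) → ℝ} (hx : 0 < x 0)
    (h : Interlace (fun i => x i.succ) l) : ∏ j, residueParams l x j =
      x 0 ^ (n + 1) * (∏ i : Fin n, ∏ j, |l j - x i.succ|) / vandermondeProd l ^ 2 := by
  rw [← abs_of_pos (Finset.prod_pos fun j _ => residueParams_pos hx h j)]
  simp only [residueParams]
  rw [Finset.prod_div_distrib, abs_div, abs_prod_erase_sub, Finset.prod_mul_distrib, abs_mul,
    Finset.prod_const, Finset.card_univ, Fintype.card_fin, abs_of_pos (pow_pos hx _),
    Finset.prod_comm]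
  simp only [Finset.abs_prod]

theorem hasFDerivAt_residueParams {l x : Fin (n + 1) → ℝ} (hx : 0 < x 0)
    (h : Interlace (fun i => x i.succ) l) :
    HasFDerivAt (residueParams l) (Matrix.toLin' (Matrix.of fun j i => residueParams l x j *
      (Matrix.of fun j i => (Fin.cons (x 0)⁻¹ fun _ => -1 : Fin (n + 1) → ℝ) i *
        (borderedCauchyMat l fun i => x i.succ)ᵀ j i) j i)).toContinuousLinearMap x := by
  rw [hasFDerivAt_pi']
  intro j
  have h1 : HasFDerivAt (fun x : Fin (n + 1) → ℝ => ∏ i : Fin n, (l j - x i.succ))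
      (∑ i : Fin n, (∏ k ∈ Finset.univ.erase i, (l j - x k.succ)) •
        -ContinuousLinearMap.proj (R := ℝ) (φ := fun _ : Fin (n + 1) => ℝ) i.succ) x :=
    HasFDerivAt.finsetProd fun i _ => (hasFDerivAt_apply i.succ x).const_sub _
  have h2 := ((hasFDerivAt_apply (𝕜 := ℝ) (0 : Fin (n + 1)) x).mul h1).mul_const
    (∏ k ∈ Finset.univ.erase j, (l j - l k))⁻¹
  refine h2.congr_fderiv ?_
  ext v
  simp only [borderedCauchyMat, residueParams, div_eq_mul_inv]
  simp [Matrix.mulVec, dotProduct, Fin.sum_univ_succ, Finset.mul_sum]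
  rw [add_comm, ← Finset.sum_neg_distrib, ← Finset.sum_neg_distrib]
  congr 1
  · field_simp
  · refine Finset.sum_congr rfl fun i _ => ?_
    rw [← Finset.mul_prod_erase Finset.univ (fun k : Fin n => l j - x k.succ) (Finset.mem_univ i)]
    have := h.sub_ne_zero i j
    field_simp

theorem abs_det_fderiv_residueParams {l x : Fin (n + 1) → ℝ} (hx : 0 < x 0)
    (h : Interlace (fun i => x i.succ) l) :
    |(Matrix.toLin' (Matrix.of fun j i => residueParams l x j *
      (Matrix.of fun j i => (Fin.cons (x 0)⁻¹ fun _ => -1 : Fin (n + 1) → ℝ) i *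
        (borderedCauchyMat l fun i => x i.succ)ᵀ j i) j i)).toContinuousLinearMap.det| =
      x 0 ^ n * vandermondeProd (fun i : Fin n => x i.succ) / vandermondeProd l := by
  rw [LinearMap.det_toContinuousLinearMap, LinearMap.det_toLin', Matrix.det_mul_column,
    Matrix.det_mul_row, Matrix.det_transpose, prod_residueParams hx h, Fin.prod_univ_succ,
    abs_mul, abs_mul, abs_det_borderedCauchyMat _ _ h.sub_ne_zero,
    abs_of_pos (vandermondeProd_pos h.strictAnti_right),
    abs_of_pos (vandermondeProd_pos h.strictAnti_left)]
  have h1 := (vandermondeProd_pos h.strictAnti_right).ne'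
  have h2 : 0 < (∏ i : Fin n, ∏ j, |l j - x i.succ|) := Finset.prod_pos fun i _ =>
    Finset.prod_pos fun j _ => abs_pos.2 (h.sub_ne_zero i j)
  rw [abs_of_pos (by positivity)]
  simp only [Fin.cons_zero, Fin.cons_succ, Finset.prod_const, abs_mul, abs_pow, abs_neg, abs_one,
    one_pow, mul_one, abs_of_pos (inv_pos.2 hx)]
  field_simp
  ring

/-- The Dixon–Anderson integral (with equal exponents). It follows by integrating
`∏ j, r j ^ (s - 1) * exp (-r j)` over the positive orthant in the coordinates given by
`residueParams`. -/
theorem lintegral_dixonAnderson {l : Fin (n + 1) → ℝ} (hl : StrictAnti l) {s : ℝ} (hs : 0 < s) :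
    ∫⁻ a in {a : Fin n → ℝ | Interlace a l},
        ENNReal.ofReal (vandermondeProd a * (∏ i, ∏ j, |l j - a i|) ^ (s - 1)) =
      ENNReal.ofReal (Real.Gamma s ^ (n + 1) / Real.Gamma ((n + 1) * s) *
        vandermondeProd l ^ (2 * s - 1)) := by
  have hV := vandermondeProd_pos hl
  have hmeas : MeasurableSet {a : Fin n → ℝ | Interlace a l} :=
    (isOpen_setOf_interlace.preimage (Continuous.prodMk_left l)).measurableSet
  have hmeas2 : MeasurableSet {x : Fin (n + 1) → ℝ | 0 < x 0 ∧ Interlace (fun i => x i.succ) l} :=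
    (measurableSet_lt measurable_const (measurable_pi_apply 0)).inter
      (hmeas.preimage (measurable_pi_lambda _ fun i => measurable_pi_apply i.succ))
  set I := ∫⁻ a in {a : Fin n → ℝ | Interlace a l},
        ENNReal.ofReal (vandermondeProd a * (∏ i, ∏ j, |l j - a i|) ^ (s - 1)) with hI
  have h1 : ∫⁻ r in Set.univ.pi fun _ : Fin (n + 1) => Set.Ioi (0 : ℝ),
      ∏ j, ENNReal.ofReal (r j ^ (s - 1) * Real.exp (-r j)) =
        ENNReal.ofReal (Real.Gamma s ^ (n + 1)) := by
    rw [volume_pi, Measure.restrict_pi_pi, lintegral_pi_prod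
      (f := fun _ t => ENNReal.ofReal (t ^ (s - 1) * Real.exp (-t))) _ fun _ => by fun_prop]
    rw [Finset.prod_const, lintegral_rpow_mul_exp_neg hs,
      ENNReal.ofReal_pow (Real.Gamma_pos_of_pos hs).le]
    simp
  have h2 : ∫⁻ r in Set.univ.pi fun _ : Fin (n + 1) => Set.Ioi (0 : ℝ),
      ∏ j, ENNReal.ofReal (r j ^ (s - 1) * Real.exp (-r j)) =
        ENNReal.ofReal (Real.Gamma ((n + 1) * s)) *
          (ENNReal.ofReal (vandermondeProd l ^ (1 - 2 * s)) * I) := by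
    have hpt : ∀ x ∈ {x : Fin (n + 1) → ℝ | 0 < x 0 ∧ Interlace (fun i => x i.succ) l},
        ENNReal.ofReal (x 0 ^ n * vandermondeProd (fun i : Fin n => x i.succ) /
          vandermondeProd l) * ∏ j, ENNReal.ofReal (residueParams l x j ^ (s - 1) *
            Real.exp (-residueParams l x j)) =
        ENNReal.ofReal (x 0 ^ ((n + 1) * s - 1) * Real.exp (-x 0)) *
          (ENNReal.ofReal (vandermondeProd l ^ (1 - 2 * s)) *
            ENNReal.ofReal (vandermondeProd (fun i : Fin n => x i.succ) *
              (∏ i : Fin n, ∏ j, |l j - x i.succ|) ^ (s - 1))) := by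
      rintro x ⟨hx, h⟩
      have hp : 0 < (∏ i : Fin n, ∏ j, |l j - x i.succ|) := Finset.prod_pos fun i _ =>
        Finset.prod_pos fun j _ => abs_pos.2 (h.sub_ne_zero i j)
      have hva := vandermondeProd_pos h.strictAnti_left
      rw [← ENNReal.ofReal_prod_of_nonneg fun j _ => mul_nonneg
          (Real.rpow_nonneg (residueParams_pos hx h j).le _) (Real.exp_pos _).le,
        ← ENNReal.ofReal_mul (by positivity), ← ENNReal.ofReal_mul (by positivity),
        ← ENNReal.ofReal_mul (by positivity), Finset.prod_mul_distrib, ← Real.exp_sum,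
        Finset.sum_neg_distrib, sum_residueParams hl.injective,
        Real.finsetProd_rpow _ _ fun j _ => (residueParams_pos hx h j).le,
        prod_residueParams hx h, Real.div_rpow (by positivity) (by positivity),
        Real.mul_rpow (by positivity) hp.le]
      congr 1
      have e1 : (x 0 ^ (n + 1)) ^ (s - 1) * x 0 ^ n = x 0 ^ ((n + 1) * s - 1) := by
        rw [← Real.rpow_natCast, ← Real.rpow_natCast, ← Real.rpow_mul hx.le, ← Real.rpow_add hx]
        congr 1
        push_cast
        ring
      have e2 : ((vandermondeProd l ^ 2) ^ (s - 1))⁻¹ * (vandermondeProd l)⁻¹ =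
          vandermondeProd l ^ (1 - 2 * s) := by
        rw [← Real.rpow_natCast, ← Real.rpow_mul hV.le, ← Real.rpow_neg hV.le,
          ← Real.rpow_neg_one, ← Real.rpow_add hV]
        congr 1
        push_cast
        ring
      rw [← e1, ← e2]
      simp only [div_eq_mul_inv]
      ring
    rw [← image_residueParams hl, lintegral_image_eq_lintegral_abs_det_fderiv_mul volume hmeas2
      (fun x hx => (hasFDerivAt_residueParams hx.1 hx.2).hasFDerivWithinAt)
      (residueParams_injOn hl.injective)]
    rw [setLIntegral_congr_fun hmeas2 fun x hx => by
      rw [abs_det_fderiv_residueParams hx.1 hx.2, hpt x hx]]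
    have hmv : Measurable fun a : Fin n → ℝ =>
        ENNReal.ofReal (vandermondeProd a * (∏ i, ∏ j, |l j - a i|) ^ (s - 1)) := by
      have := (continuous_vandermondeProd (n := n)).measurable
      fun_prop
    rw [← lintegral_indicator hmeas2, volume_pi, lintegral_pi_fin_succ]
    · rw [← lintegral_rpow_mul_exp_neg (s := (n + 1) * s) (by positivity),
        ← lintegral_indicator measurableSet_Ioi, ← lintegral_mul_const _
          (Measurable.indicator (by fun_prop) measurableSet_Ioi)]
      refine lintegral_congr fun t => ?_
      by_cases ht : 0 < t
      · rw [Set.indicator_of_mem (show t ∈ Set.Ioi (0 : ℝ) from ht), hI,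
          ← lintegral_indicator hmeas, ← lintegral_const_mul _ (hmv.indicator hmeas),
          ← lintegral_const_mul _ ((hmv.indicator hmeas).const_mul _)]
        refine lintegral_congr fun y => ?_
        by_cases hy : Interlace y l
        · rw [Set.indicator_of_mem (by exact ⟨ht, by simpa using hy⟩),
            Set.indicator_of_mem (by exact hy)]
          simp
        · rw [Set.indicator_of_notMem (fun h => hy (by simpa using h.2)),
            Set.indicator_of_notMem (by exact hy)]
          simp
      · rw [Set.indicator_of_notMem (show t ∉ Set.Ioi (0 : ℝ) from ht), zero_mul]
        refine lintegral_eq_zero_of_ae_eq_zero (Filter.Eventually.of_forall fun y => ?_)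
        exact Set.indicator_of_notMem (fun h => ht h.1) _
    · refine Measurable.indicator ?_ hmeas2
      have := hmv.comp (measurable_pi_lambda (fun (x : Fin (n + 1) → ℝ) (i : Fin n) => x i.succ)
        fun i => measurable_pi_apply i.succ)
      exact Measurable.mul (by fun_prop) (this.const_mul _)
  have hG : 0 < Real.Gamma ((n + 1) * s) := Real.Gamma_pos_of_pos (by positivity)
  rw [h1] at h2
  have hinv : ENNReal.ofReal (vandermondeProd l ^ (2 * s - 1) / Real.Gamma ((n + 1) * s)) *
      (ENNReal.ofReal (Real.Gamma ((n + 1) * s)) *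
        ENNReal.ofReal (vandermondeProd l ^ (1 - 2 * s))) = 1 := by
    rw [← ENNReal.ofReal_mul hG.le, ← ENNReal.ofReal_mul (by positivity), ENNReal.ofReal_eq_one]
    have : vandermondeProd l ^ (2 * s - 1) * vandermondeProd l ^ (1 - 2 * s) = 1 := by
      rw [← Real.rpow_add hV, show 2 * s - 1 + (1 - 2 * s) = 0 by ring, Real.rpow_zero]
    field_simp
    linarith
  rw [← one_mul I, ← hinv, mul_assoc, mul_assoc, ← h2, ← ENNReal.ofReal_mul (by positivity)]
  congr 1
  ring

end DixonAnderson

/-! ### Conjugation and the dimension of the algebra -/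

namespace RealNormedDivisionAlgebra

theorem smul_one_injective {F : Type*} [NormedDivisionRing F] [InnerProductSpace ℝ F] :
    Function.Injective fun r : ℝ => r • (1 : F) :=
  smul_left_injective ℝ one_ne_zero

variable {F : Type*} [NormedDivisionRing F] [InnerProductSpace ℝ F] [StarRing F]
  [RealNormedDivisionAlgebra F]

theorem star_smul_one (r : ℝ) : star (r • (1 : F)) = r • (1 : F) := by
  by_cases hr : r = 0
  · simp [hr]
  · have h := star_mul_self (r • (1 : F))
    rw [norm_smul, norm_one, mul_one, Real.norm_eq_abs, sq_abs, sq, mul_smul, mul_smul_comm,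
      mul_one] at h
    exact smul_right_injective F hr h

theorem star_smul_real (r : ℝ) (x : F) : star (r • x) = r • star x := by
  rw [← one_mul x, ← smul_mul_assoc, star_mul, star_smul_one, mul_smul_comm, mul_one, one_mul]

theorem mul_star_self (x : F) : x * star x = (‖x‖ ^ 2) • (1 : F) := by
  have h := star_mul_self (star x)
  rwa [star_star, norm_star] at h

theorem add_star_self (x : F) : x + star x = (2 * inner ℝ (1 : F) x) • (1 : F) := by
  have h := star_mul_self (1 + x)
  rw [norm_add_sq_real, star_add, star_one, add_mul, mul_add, mul_add, star_mul_self, norm_one,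
    add_smul, add_smul] at h
  simp only [one_pow, one_smul, mul_one, one_mul] at h
  have h2 : (1 + x + (star x + (‖x‖ ^ 2) • (1 : F))) = 1 + (x + star x) + (‖x‖ ^ 2) • (1 : F) := by
    abel
  rw [h2] at h
  exact add_left_cancel (add_right_cancel h)

theorem star_eq_neg {x : F} (hx : inner ℝ (1 : F) x = 0) : star x = -x := by
  have h := add_star_self x
  rw [hx, mul_zero, zero_smul] at h
  exact (neg_eq_of_add_eq_zero_right h).symm

theorem inner_one_eq_zero_of_star_eq_neg {x : F} (hx : star x = -x) : inner ℝ (1 : F) x = 0 := by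
  have h := add_star_self x
  rw [hx, add_neg_cancel, ← zero_smul ℝ (1 : F)] at h
  linarith [smul_one_injective h]

theorem mul_self_of_inner_one {x : F} (hx : inner ℝ (1 : F) x = 0) :
    x * x = -((‖x‖ ^ 2) • (1 : F)) := by
  rw [← star_mul_self, star_eq_neg hx, neg_mul, neg_neg]

theorem mul_add_mul_swap {x y : F} (hx : inner ℝ (1 : F) x = 0) (hy : inner ℝ (1 : F) y = 0) :
    x * y + y * x = -((2 * inner ℝ x y) • (1 : F)) := by
  have h := mul_self_of_inner_one (x := x + y) (by rw [inner_add_right, hx, hy, add_zero])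
  rw [norm_add_sq_real, add_mul, mul_add, mul_add, mul_self_of_inner_one hx,
    mul_self_of_inner_one hy, add_smul, add_smul] at h
  have h2 : x * y + y * x = (-((‖x‖ ^ 2) • (1 : F)) + x * y + (y * x + -((‖y‖ ^ 2) • (1 : F)))) +
      (‖x‖ ^ 2) • (1 : F) + (‖y‖ ^ 2) • (1 : F) := by abel
  rw [h2, h]
  abel

theorem mul_eq_neg_mul_swap {x y : F} (hx : inner ℝ (1 : F) x = 0) (hy : inner ℝ (1 : F) y = 0)
    (hxy : inner ℝ x y = 0) : x * y = -(y * x) := by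
  have h := mul_add_mul_swap hx hy
  rw [hxy, mul_zero, zero_smul, neg_zero] at h
  exact eq_neg_of_add_eq_zero_left h

theorem inner_eq_zero_of_mul_eq_neg {x y : F} (hx : inner ℝ (1 : F) x = 0)
    (hy : inner ℝ (1 : F) y = 0) (hxy : x * y = -(y * x)) : inner ℝ x y = 0 := by
  have h := mul_add_mul_swap hx hy
  rw [hxy, neg_add_cancel, zero_eq_neg, ← zero_smul ℝ (1 : F)] at h
  linarith [smul_one_injective h]

/-- If `i`, `j` are orthonormal and imaginary, then so are `i`, `j`, `i * j`, and an imaginary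
`l` orthogonal to all three would satisfy `l * (i * j) = (i * j) * l = -(l * (i * j))`. -/
theorem finrank_eq_four_of_orthonormal {i j : F} (hi : inner ℝ (1 : F) i = 0)
    (hj : inner ℝ (1 : F) j = 0) (hij : inner ℝ i j = 0) (hi1 : ‖i‖ = 1) (hj1 : ‖j‖ = 1) :
    Module.finrank ℝ F = 4 := by
  have hc := mul_eq_neg_mul_swap hi hj hij
  have hk : inner ℝ (1 : F) (i * j) = 0 := by
    refine inner_one_eq_zero_of_star_eq_neg ?_
    rw [star_mul, star_eq_neg hi, star_eq_neg hj, neg_mul_neg, hc, neg_neg]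
  have hik : inner ℝ i (i * j) = 0 := by
    refine inner_eq_zero_of_mul_eq_neg hi hk ?_
    rw [mul_assoc, ← mul_neg, ← hc]
  have hjk : inner ℝ j (i * j) = 0 := by
    refine inner_eq_zero_of_mul_eq_neg hj hk ?_
    rw [← mul_assoc, ← neg_mul, hc, neg_neg]
  have hk1 : ‖i * j‖ = 1 := by rw [norm_mul, hi1, hj1, one_mul]
  have hon : Orthonormal ℝ ![(1 : F), i, j, i * j] := by
    rw [orthonormal_iff_ite]
    intro p q
    fin_cases p <;> fin_cases q <;>
      simp [hi, hj, hk, hij, hik, hjk, hi1, hj1, hk1, real_inner_comm]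
      <;> (rw [real_inner_comm]; assumption)
  have hbot : (Submodule.span ℝ (Set.range ![(1 : F), i, j, i * j]))ᗮ = ⊥ := by
    rw [Submodule.eq_bot_iff]
    intro l hl
    rw [Submodule.mem_orthogonal] at hl
    have hl' : ∀ p, inner ℝ (![(1 : F), i, j, i * j] p) l = 0 := fun p =>
      hl _ (Submodule.subset_span ⟨p, rfl⟩)
    have l1 : inner ℝ (1 : F) l = 0 := hl' 0
    have li := mul_eq_neg_mul_swap hi l1 (hl' 1)
    have lj := mul_eq_neg_mul_swap hj l1 (hl' 2)
    have lk : i * j * l = -(l * (i * j)) := mul_eq_neg_mul_swap hk l1 (hl' 3)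
    have lk2 : i * j * l = l * (i * j) := by
      rw [mul_assoc, lj, mul_neg, ← mul_assoc, li, neg_mul, neg_neg, mul_assoc]
    have h0 : l * (i * j) = 0 := by
      refine (smul_eq_zero.1 (?_ : (2 : ℝ) • (l * (i * j)) = 0)).resolve_left two_ne_zero
      rw [two_smul, add_eq_zero_iff_eq_neg, ← lk, lk2]
    rcases mul_eq_zero.1 h0 with h | h
    · exact h
    · rw [h, norm_zero] at hk1
      exact absurd hk1 zero_ne_one
  have := Module.finrank_eq_card_basis (OrthonormalBasis.mkOfOrthogonalEqBot hon hbot).toBasis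
  simpa using this

/-- Frobenius' theorem on the possible dimensions. -/
theorem finrank_eq_one_or_two_or_four :
    Module.finrank ℝ F = 1 ∨ Module.finrank ℝ F = 2 ∨ Module.finrank ℝ F = 4 := by
  have hsum := Submodule.finrank_add_finrank_orthogonal (ℝ ∙ (1 : F))
  rw [finrank_span_singleton one_ne_zero] at hsum
  rcases lt_or_ge (Module.finrank ℝ (ℝ ∙ (1 : F))ᗮ) 2 with h | h
  · omega
  · right; right
    have hb := (stdOrthonormalBasis ℝ (ℝ ∙ (1 : F))ᗮ).orthonormal
    set b := stdOrthonormalBasis ℝ (ℝ ∙ (1 : F))ᗮ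
    have him : ∀ p, inner ℝ (1 : F) (b p : F) = 0 := fun p =>
      Submodule.mem_orthogonal_singleton_iff_inner_right.1 (b p).2
    refine finrank_eq_four_of_orthonormal (him ⟨0, by omega⟩) (him ⟨1, by omega⟩) ?_ ?_ ?_
    · exact hb.2 (by simp)
    · exact hb.1 _
    · exact hb.1 _

end RealNormedDivisionAlgebra

/-! ### Unitary matrices and eigenvalues -/

namespace RealNormedDivisionAlgebra

section UnitaryMatrices

variable {F : Type*} [NormedDivisionRing F] [InnerProductSpace ℝ F] [StarRing F]
  [RealNormedDivisionAlgebra F] {m : ℕ}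

theorem star_dotProduct_self (v : Fin m → F) :
    star v ⬝ᵥ v = (∑ i, ‖v i‖ ^ 2) • (1 : F) := by
  simp [dotProduct, star_mul_self, Finset.sum_smul]

theorem sum_norm_sq_mulVec {H : Matrix (Fin m) (Fin m) F} (hH : H ∈ unitary _) (v : Fin m → F) :
    ∑ i, ‖(H *ᵥ v) i‖ ^ 2 = ∑ i, ‖v i‖ ^ 2 := by
  refine smul_one_injective (F := F) ?_
  simp only [← star_dotProduct_self]
  rw [Matrix.star_mulVec, Matrix.dotProduct_mulVec, Matrix.vecMul_vecMul,
    ← Matrix.star_eq_conjTranspose, (Unitary.mem_iff.1 hH).1, Matrix.vecMul_one]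

theorem sum_norm_sq_vecMul {H : Matrix (Fin m) (Fin m) F} (hH : H ∈ unitary _) (v : Fin m → F) :
    ∑ i, ‖(v ᵥ* Hᴴ) i‖ ^ 2 = ∑ i, ‖v i‖ ^ 2 := by
  have h := sum_norm_sq_mulVec hH (star v)
  have e : v ᵥ* Hᴴ = star (H *ᵥ star v) := by rw [Matrix.star_mulVec, star_star]
  simpa [e, norm_star] using h

theorem sum_norm_sq_conj {H : Matrix (Fin m) (Fin m) F} (hH : H ∈ unitary _)
    (A : Matrix (Fin m) (Fin m) F) :
    ∑ i, ∑ j, ‖(H * A * Hᴴ) i j‖ ^ 2 = ∑ i, ∑ j, ‖A i j‖ ^ 2 := by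
  have h1 : ∀ i, ∑ j, ‖(H * A * Hᴴ) i j‖ ^ 2 = ∑ j, ‖(H * A) i j‖ ^ 2 := fun i => by
    simpa [Matrix.mul_apply_eq_vecMul] using sum_norm_sq_vecMul hH ((H * A) i)
  have h2 : ∀ j, ∑ i, ‖(H * A) i j‖ ^ 2 = ∑ i, ‖A i j‖ ^ 2 := fun j => by
    simpa [Matrix.mulVec, Matrix.mul_apply, dotProduct] using sum_norm_sq_mulVec hH fun i => A i j
  simp only [h1]
  rw [Finset.sum_comm, Finset.sum_congr rfl fun j _ => h2 j, Finset.sum_comm]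

variable (F) in
/-- The real diagonal matrix with diagonal entries `l i`, as a matrix over `F`. -/
def realDiagonal (l : Fin m → ℝ) : Matrix (Fin m) (Fin m) F :=
  Matrix.diagonal fun i => l i • (1 : F)

theorem realDiagonal_mulVec (l : Fin m → ℝ) (v : Fin m → F) (i : Fin m) :
    (realDiagonal F l *ᵥ v) i = l i • v i := by
  rw [realDiagonal, Matrix.mulVec_diagonal, smul_mul_assoc, one_mul]

theorem isHermitian_realDiagonal (l : Fin m → ℝ) : (realDiagonal F l).IsHermitian := by
  rw [Matrix.IsHermitian, realDiagonal, Matrix.diagonal_conjTranspose]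
  congr 1
  ext i
  simp [star_smul_one]

theorem mul_realDiagonal_apply (M : Matrix (Fin m) (Fin m) F) (l : Fin m → ℝ) (i j : Fin m) :
    (M * realDiagonal F l) i j = l j • M i j := by
  rw [realDiagonal, Matrix.mul_diagonal, mul_smul_comm, mul_one]

/-- A unitary matrix as a real linear automorphism of `F ^ m`. -/
def unitaryLinearEquiv (H : UGroup F m) : (Fin m → F) ≃ₗ[ℝ] (Fin m → F) where
  toFun v := (H : Matrix (Fin m) (Fin m) F) *ᵥ v
  invFun v := (H : Matrix (Fin m) (Fin m) F)ᴴ *ᵥ v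
  map_add' v w := Matrix.mulVec_add _ v w
  map_smul' c v := Matrix.mulVec_smul _ c v
  left_inv v := by
    change _ *ᵥ (_ *ᵥ v) = v
    rw [Matrix.mulVec_mulVec, ← Matrix.star_eq_conjTranspose, (Unitary.mem_iff.1 H.2).1,
      Matrix.one_mulVec]
  right_inv v := by
    change _ *ᵥ (_ *ᵥ v) = v
    rw [Matrix.mulVec_mulVec, ← Matrix.star_eq_conjTranspose, (Unitary.mem_iff.1 H.2).2,
      Matrix.one_mulVec]

theorem finrank_realEigenspace_realDiagonal (l : Fin m → ℝ) (t : ℝ) :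
    Module.finrank ℝ (realEigenspace (realDiagonal F l) t) =
      Module.finrank ℝ F * (Finset.univ.filter fun i => l i = t).card := by
  classical
  have e : realEigenspace (realDiagonal F l) t =
      ⨅ i ∈ {i | l i ≠ t}, LinearMap.ker (LinearMap.proj i : (Fin m → F) →ₗ[ℝ] F) := by
    ext v
    simp only [Submodule.mem_iInf, LinearMap.mem_ker, LinearMap.proj_apply, Set.mem_ofPred_eq]
    change realDiagonal F l *ᵥ v = t • v ↔ _
    rw [funext_iff]
    refine forall_congr' fun i => ?_
    rw [realDiagonal_mulVec, Pi.smul_apply, ← sub_eq_zero, ← sub_smul, smul_eq_zero, sub_eq_zero]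
    tauto
  rw [e, (LinearMap.iInfKerProjEquiv ℝ (fun _ : Fin m => F) (I := {i | l i = t})
    (J := {i | l i ≠ t}) (Set.disjoint_left.2 fun i h h' => h' h)
    fun i _ => (em (l i = t)).elim Or.inl Or.inr).finrank_eq, Module.finrank_pi_fintype]
  simp only [Finset.sum_const, smul_eq_mul, Finset.card_univ]
  rw [mul_comm, Fintype.card_subtype]
  simp

theorem isOrderedEigenvalues_conj_realDiagonal (H : UGroup F m) {l : Fin m → ℝ}
    (hl : Antitone l) :
    IsOrderedEigenvalues ((H : Matrix (Fin m) (Fin m) F) * realDiagonal F l *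
      (H : Matrix (Fin m) (Fin m) F)ᴴ) l := by
  refine ⟨hl, fun t => ?_⟩
  suffices h : realEigenspace ((H : Matrix (Fin m) (Fin m) F) * realDiagonal F l *
      (H : Matrix (Fin m) (Fin m) F)ᴴ) t = (realEigenspace (realDiagonal F l) t).map
        (unitaryLinearEquiv H : (Fin m → F) →ₗ[ℝ] (Fin m → F)) by
    rw [h, ← finrank_realEigenspace_realDiagonal (F := F)]
    exact LinearEquiv.finrank_map_eq (unitaryLinearEquiv H) _
  ext v
  rw [Submodule.mem_map_equiv]
  change _ *ᵥ v = t • v ↔ _ *ᵥ ((unitaryLinearEquiv H).symm v) =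
    t • ((unitaryLinearEquiv H).symm v)
  rw [← map_smul, ← LinearEquiv.symm_apply_eq, LinearEquiv.symm_symm]
  change _ ↔ (H : Matrix (Fin m) (Fin m) F) *ᵥ (_ *ᵥ ((H : Matrix (Fin m) (Fin m) F)ᴴ *ᵥ v)) = _
  rw [Matrix.mulVec_mulVec, Matrix.mulVec_mulVec]

/-- The list is determined by its multiplicities. -/
theorem isOrderedEigenvalues_unique {S : Matrix (Fin m) (Fin m) F} {l l' : Fin m → ℝ}
    (h : IsOrderedEigenvalues S l) (h' : IsOrderedEigenvalues S l') : l = l' := by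
  have hc : ∀ t, (Finset.univ.filter fun i => l i = t).card =
      (Finset.univ.filter fun i => l' i = t).card := fun t =>
    Nat.eq_of_mul_eq_mul_left (Module.finrank_pos (R := ℝ) (M := F)) ((h.2 t).symm.trans (h'.2 t))
  have hm : Finset.univ.val.map l = Finset.univ.val.map l' := by
    ext t
    rw [Multiset.count_map, Multiset.count_map]
    simpa [Finset.card_def, eq_comm] using hc t
  rw [Fin.univ_val_map, Fin.univ_val_map, Multiset.coe_eq_coe] at hm
  exact List.ofFn_injective (hm.eq_of_sortedGE h.1.sortedGE_ofFn h'.1.sortedGE_ofFn)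

theorem orderedEigenvalues_conj_realDiagonal (H : UGroup F m) {l : Fin m → ℝ}
    (hl : Antitone l) :
    orderedEigenvalues ((H : Matrix (Fin m) (Fin m) F) * realDiagonal F l *
      (H : Matrix (Fin m) (Fin m) F)ᴴ) = l := by
  have h : ∃ l', IsOrderedEigenvalues ((H : Matrix (Fin m) (Fin m) F) * realDiagonal F l *
      (H : Matrix (Fin m) (Fin m) F)ᴴ) l' := ⟨l, isOrderedEigenvalues_conj_realDiagonal H hl⟩
  rw [orderedEigenvalues, dif_pos h]
  exact isOrderedEigenvalues_unique h.choose_spec (isOrderedEigenvalues_conj_realDiagonal H hl)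

theorem isPosDefHermitian_conj_realDiagonal (H : UGroup F m) (l : Fin m → ℝ) :
    IsPosDefHermitian ((H : Matrix (Fin m) (Fin m) F) * realDiagonal F l *
      (H : Matrix (Fin m) (Fin m) F)ᴴ) ↔ ∀ i, 0 < l i := by
  have key : ∀ x : Fin m → F, inner ℝ (1 : F) (star x ⬝ᵥ (((H : Matrix (Fin m) (Fin m) F) *
      realDiagonal F l * (H : Matrix (Fin m) (Fin m) F)ᴴ) *ᵥ x)) =
        ∑ i, l i * ‖(unitaryLinearEquiv H).symm x i‖ ^ 2 := by
    intro x
    have e : star x ⬝ᵥ (((H : Matrix (Fin m) (Fin m) F) *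
      realDiagonal F l * (H : Matrix (Fin m) (Fin m) F)ᴴ) *ᵥ x) =
        (∑ i, l i * ‖(unitaryLinearEquiv H).symm x i‖ ^ 2) • (1 : F) := by
      rw [← Matrix.mulVec_mulVec, ← Matrix.mulVec_mulVec, Matrix.dotProduct_mulVec]
      have : star x ᵥ* (H : Matrix (Fin m) (Fin m) F) = star ((unitaryLinearEquiv H).symm x) := by
        change _ = star ((H : Matrix (Fin m) (Fin m) F)ᴴ *ᵥ x)
        rw [Matrix.star_mulVec, Matrix.conjTranspose_conjTranspose]
      rw [this]
      change star ((unitaryLinearEquiv H).symm x) ⬝ᵥ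
        (realDiagonal F l *ᵥ ((unitaryLinearEquiv H).symm x)) = _
      simp only [dotProduct, realDiagonal_mulVec, Pi.star_apply, mul_smul_comm, star_mul_self,
        smul_smul, Finset.sum_smul]
    rw [e, inner_smul_right, real_inner_self_eq_norm_sq, norm_one]
    ring
  constructor
  · rintro ⟨-, h⟩ i
    have h1 := h (unitaryLinearEquiv H (Pi.single i 1)) (by simp)
    rw [key, LinearEquiv.symm_apply_apply, Finset.sum_eq_single i] at h1
    · simpa using h1
    · intro j _ hj
      simp [hj]
    · simp
  · intro hl
    refine ⟨Matrix.isHermitian_mul_mul_conjTranspose _ (isHermitian_realDiagonal l), fun x hx => ?_⟩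
    rw [key]
    have hy : (unitaryLinearEquiv H).symm x ≠ 0 := by simpa using hx
    obtain ⟨i, hi⟩ := Function.ne_iff.1 hy
    exact Finset.sum_pos' (fun j _ => mul_nonneg (hl j).le (sq_nonneg _))
      ⟨i, Finset.mem_univ i, mul_pos (hl i) (pow_pos (norm_pos_iff.2 hi) 2)⟩

end UnitaryMatrices

/-! ### Bordered matrices -/

section BorderedMatrices

variable {F : Type*} [NormedDivisionRing F] [InnerProductSpace ℝ F] [StarRing F] {m n : ℕ}

/-- The Hermitian matrix with corner entry `d`, first row `v` and lower right block `A`. -/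
def borderMat (d : ℝ) (v : Fin n → F) (A : Matrix (Fin n) (Fin n) F) :
    Matrix (Fin (n + 1)) (Fin (n + 1)) F :=
  Matrix.of (Fin.cons (Fin.cons (d • 1) v) fun i => Fin.cons (star (v i)) (A i))

theorem borderMat_one_mem_unitary {H : Matrix (Fin n) (Fin n) F} (hH : H ∈ unitary _) :
    borderMat 1 0 H ∈ unitary (Matrix (Fin (n + 1)) (Fin (n + 1)) F) := by
  rw [Unitary.mem_iff] at hH ⊢
  constructor
  · ext i j
    have h := fun i j => congrFun (congrFun hH.1 i) j
    refine Fin.cases ?_ (fun i => ?_) i <;> refine Fin.cases ?_ (fun j => ?_) j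
    all_goals simp [borderMat, Matrix.mul_apply, Fin.sum_univ_succ, Matrix.one_apply]
    · exact (Fin.succ_ne_zero j).symm
    · simpa [Matrix.mul_apply, Matrix.one_apply] using h i j
  · ext i j
    have h := fun i j => congrFun (congrFun hH.2 i) j
    refine Fin.cases ?_ (fun i => ?_) i <;> refine Fin.cases ?_ (fun j => ?_) j
    all_goals simp [borderMat, Matrix.mul_apply, Fin.sum_univ_succ, Matrix.one_apply]
    · exact (Fin.succ_ne_zero j).symm
    · simpa [Matrix.mul_apply, Matrix.one_apply] using h i j

theorem borderMat_conj (H : Matrix (Fin n) (Fin n) F) (d : ℝ) (v : Fin n → F)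
    (A : Matrix (Fin n) (Fin n) F) :
    borderMat 1 0 H * borderMat d v A * (borderMat 1 0 H)ᴴ =
      borderMat d (v ᵥ* Hᴴ) (H * A * Hᴴ) := by
  ext i j
  refine Fin.cases ?_ (fun i => ?_) i <;> refine Fin.cases ?_ (fun j => ?_) j
  all_goals simp [borderMat, Matrix.mul_apply, Fin.sum_univ_succ, Matrix.vecMul, dotProduct]

/-- The positions above the diagonal are those in the first row and the others. -/
noncomputable def upperEquiv (n : ℕ) : Fin n ⊕ {p : Fin n × Fin n // p.1 < p.2} ≃
    {p : Fin (n + 1) × Fin (n + 1) // p.1 < p.2} :=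
  Equiv.ofBijective
    (Sum.elim (fun j => ⟨(0, j.succ), Fin.succ_pos j⟩)
      fun p => ⟨(p.1.1.succ, p.1.2.succ), Fin.succ_lt_succ_iff.2 p.2⟩) (by
    constructor
    · rintro (j | ⟨⟨p, q⟩, hp⟩) (j' | ⟨⟨p', q'⟩, hp'⟩) h
      · simpa using h
      · simp [(Fin.succ_ne_zero _).symm] at h
      · simp at h
      · simpa using h
    · rintro ⟨⟨i, j⟩, h⟩
      obtain ⟨j, rfl⟩ := Fin.exists_succ_eq.2 (Fin.pos_iff_ne_zero.1 ((Fin.zero_le i).trans_lt h))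
      refine Fin.cases (fun h => ⟨Sum.inl j, rfl⟩) (fun i h => ?_) i h
      exact ⟨Sum.inr ⟨(i, j), Fin.succ_lt_succ_iff.1 h⟩, rfl⟩)

theorem hermitianOfCoords_succ (d : ℝ) (x : Fin n → ℝ) (v : Fin n → F)
    (u : {p : Fin n × Fin n // p.1 < p.2} → F) :
    hermitianOfCoords (m := n + 1) (Fin.cons d x, fun p => Sum.elim v u ((upperEquiv n).symm p)) =
      borderMat d v (hermitianOfCoords (x, u)) := by
  have hl : ∀ (j : Fin n) h, (upperEquiv n).symm ⟨(0, j.succ), h⟩ = Sum.inl j := fun j h =>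
    (Equiv.symm_apply_eq _).2 rfl
  have hr : ∀ (i j : Fin n) (h : i < j) h', (upperEquiv n).symm ⟨(i.succ, j.succ), h'⟩ =
    Sum.inr ⟨(i, j), h⟩ := fun i j h h' => (Equiv.symm_apply_eq _).2 rfl
  ext i j
  refine Fin.cases ?_ (fun i => ?_) i <;> refine Fin.cases ?_ (fun j => ?_) j
  · simp [hermitianOfCoords, borderMat]
  · simp [hermitianOfCoords, borderMat, hl]
  · simp [hermitianOfCoords, borderMat, hl]
  · rcases lt_trichotomy i j with h | rfl | h
    · simp [hermitianOfCoords, borderMat, hr _ _ h, h]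
    · simp [hermitianOfCoords, borderMat]
    · simp [hermitianOfCoords, borderMat, hr _ _ h, h, h.not_gt]

variable [RealNormedDivisionAlgebra F]

theorem continuous_borderMat : Continuous
    fun p : ℝ × (Fin n → F) × Matrix (Fin n) (Fin n) F => borderMat p.1 p.2.1 p.2.2 := by
  refine continuous_matrix fun i j => ?_
  refine Fin.cases ?_ (fun i => ?_) i <;> refine Fin.cases ?_ (fun j => ?_) j
  · simp only [borderMat, Matrix.of_apply, Fin.cons_zero]; fun_prop
  · simp only [borderMat, Matrix.of_apply, Fin.cons_zero, Fin.cons_succ]; fun_prop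
  · simp only [borderMat, Matrix.of_apply, Fin.cons_zero, Fin.cons_succ]; fun_prop
  · simp only [borderMat, Matrix.of_apply, Fin.cons_succ]
    exact (continuous_snd.comp continuous_snd).matrix_elem i j

/-- A left inverse is a right inverse, here for matrices over a noncommutative ring: `M` acts
injectively on the finite-dimensional real vector space `F ^ m`. -/
theorem mul_conjTranspose_eq_one {M : Matrix (Fin m) (Fin m) F} (h : Mᴴ * M = 1) :
    M * Mᴴ = 1 := by
  let T : (Fin m → F) →ₗ[ℝ] (Fin m → F) :=
    { toFun := fun v => M *ᵥ v
      map_add' := fun v w => Matrix.mulVec_add _ v w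
      map_smul' := fun c v => Matrix.mulVec_smul _ c v }
  have hT : Function.LeftInverse (fun v => Mᴴ *ᵥ v) T := fun v => by
    change Mᴴ *ᵥ (M *ᵥ v) = v
    rw [Matrix.mulVec_mulVec, h, Matrix.one_mulVec]
  have hT2 := LinearMap.injective_iff_surjective.1 hT.injective
  refine Matrix.ext_of_mulVec_single fun i => ?_
  obtain ⟨w, hw⟩ := hT2 (Pi.single i 1)
  change M *ᵥ w = _ at hw
  rw [← hw, Matrix.mulVec_mulVec, Matrix.mul_assoc, h, Matrix.mul_one, Matrix.one_mulVec]

/-- An arrowhead matrix with diagonal part `a` is unitarily equivalent to the diagonal matrix of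
the roots `l` of its secular equation: the vectors `(1, star (v i) / (l j - a i))` are orthogonal
eigenvectors. -/
theorem exists_unitary_borderMat_eq {a : Fin n → ℝ} {l : Fin (n + 1) → ℝ} (h : Interlace a l)
    {d : ℝ} {v : Fin n → F} (hd : arrowParams a l = Fin.cons d fun i => ‖v i‖ ^ 2) :
    ∃ H : UGroup F (n + 1), borderMat d v (realDiagonal F a) =
      (H : Matrix (Fin (n + 1)) (Fin (n + 1)) F) * realDiagonal F l *
        (H : Matrix (Fin (n + 1)) (Fin (n + 1)) F)ᴴ := by
  -- the secular equation in its rational form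
  have hsec : ∀ j, d + ∑ i, ‖v i‖ ^ 2 * (l j - a i)⁻¹ = l j := by
    intro j
    have h1 := congrArg (Polynomial.eval (l j))
      (secularPoly_arrowParams h.strictAnti_left.injective l)
    rw [hd, Polynomial.eval_prod, Finset.prod_eq_zero (Finset.mem_univ j) (by simp)] at h1
    simp only [secularPoly, Fin.cons_zero, Fin.cons_succ, Polynomial.eval_sub,
      Polynomial.eval_mul, Polynomial.eval_prod, Polynomial.eval_finsetSum, Polynomial.eval_X,
      Polynomial.eval_C] at h1
    have hp : ∏ i, (l j - a i) ≠ 0 := Finset.prod_ne_zero_iff.2 fun i _ => h.sub_ne_zero i j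
    have h2 : ∑ i, ‖v i‖ ^ 2 * ∏ k ∈ Finset.univ.erase i, (l j - a k) =
        (∑ i, ‖v i‖ ^ 2 * (l j - a i)⁻¹) * ∏ i, (l j - a i) := by
      rw [Finset.sum_mul]
      refine Finset.sum_congr rfl fun i _ => ?_
      rw [← Finset.mul_prod_erase Finset.univ (fun k => l j - a k) (Finset.mem_univ i)]
      have := h.sub_ne_zero i j
      field_simp
    rw [h2, ← sub_mul] at h1
    linarith [(mul_eq_zero.1 h1).resolve_right hp]
  set N : Fin (n + 1) → ℝ := fun j => 1 + ∑ i, ‖v i‖ ^ 2 * ((l j - a i)⁻¹) ^ 2 with hN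
  have hNpos : ∀ j, 0 < N j := fun j => by positivity
  -- subtract the secular equations of `l j` and `l k`
  have horth : ∀ j k, j ≠ k → 1 + ∑ i, ‖v i‖ ^ 2 * ((l j - a i)⁻¹ * (l k - a i)⁻¹) = 0 := by
    intro j k hjk
    have hne : l j - l k ≠ 0 := sub_ne_zero.2 fun e => hjk (h.strictAnti_right.injective e)
    refine (mul_eq_zero.1 (?_ : (l j - l k) * _ = 0)).resolve_left hne
    have e1 : ∀ i, (l j - l k) * (‖v i‖ ^ 2 * ((l j - a i)⁻¹ * (l k - a i)⁻¹)) =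
        ‖v i‖ ^ 2 * (l k - a i)⁻¹ - ‖v i‖ ^ 2 * (l j - a i)⁻¹ := by
      intro i
      have := h.sub_ne_zero i j
      have := h.sub_ne_zero i k
      field_simp
      ring
    rw [mul_add, Finset.mul_sum, Finset.sum_congr rfl fun i _ => e1 i, Finset.sum_sub_distrib]
    linarith [hsec j, hsec k]
  set M : Matrix (Fin (n + 1)) (Fin (n + 1)) F := Matrix.of fun i j =>
    (Real.sqrt (N j))⁻¹ • (Fin.cons 1 fun i => (l j - a i)⁻¹ • star (v i) : Fin (n + 1) → F) i
    with hM
  have hMM : Mᴴ * M = 1 := by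
    ext j k
    have e1 : (Mᴴ * M) j k = ((Real.sqrt (N j))⁻¹ * (Real.sqrt (N k))⁻¹ *
        (1 + ∑ i, ‖v i‖ ^ 2 * ((l j - a i)⁻¹ * (l k - a i)⁻¹))) • (1 : F) := by
      rw [Matrix.mul_apply, Fin.sum_univ_succ, mul_add, add_smul, Finset.mul_sum, Finset.sum_smul]
      congr 1
      · simp [hM, star_smul_real, smul_smul, mul_comm]
      · refine Finset.sum_congr rfl fun i _ => ?_
        simp only [hM, Matrix.conjTranspose_apply, Matrix.of_apply, Fin.cons_succ, star_smul_real,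
          star_star, smul_mul_assoc, mul_smul_comm, mul_star_self, smul_smul]
        congr 1
        ring
    rw [e1]
    by_cases hjk : j = k
    · subst hjk
      have e2 : 1 + ∑ i, ‖v i‖ ^ 2 * ((l j - a i)⁻¹ * (l j - a i)⁻¹) = N j := by
        simp only [hN, sq]
      rw [e2, Matrix.one_apply_eq, ← mul_inv, Real.mul_self_sqrt (hNpos j).le,
        inv_mul_cancel₀ (hNpos j).ne', one_smul]
    · rw [horth j k hjk, mul_zero, zero_smul, Matrix.one_apply_ne hjk]
  have hMM' := mul_conjTranspose_eq_one hMM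
  have hSM : borderMat d v (realDiagonal F a) * M = M * realDiagonal F l := by
    ext i j
    rw [mul_realDiagonal_apply, Matrix.mul_apply, Fin.sum_univ_succ]
    refine Fin.cases ?_ (fun i => ?_) i
    · simp only [hM, borderMat, Matrix.of_apply, Fin.cons_zero, Fin.cons_succ, mul_smul_comm,
        mul_one, mul_star_self, smul_smul]
      rw [← Finset.sum_smul, ← add_smul]
      congr 1
      rw [mul_comm (l j)]
      conv_rhs => rw [← hsec j, mul_add, Finset.mul_sum]
      congr 1
      exact Finset.sum_congr rfl fun i _ => by ring
    · simp only [hM, borderMat, Matrix.of_apply, Fin.cons_zero, Fin.cons_succ, mul_smul_comm,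
        mul_one, realDiagonal]
      rw [Finset.sum_eq_single i]
      · simp only [Matrix.diagonal_apply_eq, smul_mul_assoc, one_mul, smul_smul]
        rw [← add_smul]
        congr 1
        have := h.sub_ne_zero i j
        field_simp
        ring
      · intro k _ hk
        simp [Matrix.diagonal_apply_ne _ hk.symm]
      · simp
  refine ⟨⟨M, Unitary.mem_iff.2 ⟨hMM, hMM'⟩⟩, ?_⟩
  change _ = M * realDiagonal F l * Mᴴ
  rw [← hSM, Matrix.mul_assoc, hMM', Matrix.mul_one]

end BorderedMatrices

end RealNormedDivisionAlgebra

/-! ### Volume-preserving linear maps -/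

/-- A linear map preserving the "unit ball" of a definite function preserves Lebesgue measure. -/
theorem measurePreserving_of_forall_eq {V : Type*} [NormedAddCommGroup V] [NormedSpace ℝ V]
    [MeasurableSpace V] [BorelSpace V] [FiniteDimensional ℝ V] (μ : Measure V)
    [μ.IsAddHaarMeasure] (T : V →ₗ[ℝ] V) (q : V → ℝ) (hqc : Continuous q) (hq0 : q 0 = 0)
    (hdef : ∀ x, q x = 0 → x = 0) (hb : Bornology.IsBounded {x | q x < 1})
    (hT : ∀ x, q (T x) = q x) : MeasurePreserving T μ μ := by
  have hinj : Function.Injective T := by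
    rw [← LinearMap.ker_eq_bot, LinearMap.ker_eq_bot']
    intro x hx
    exact hdef x (by rw [← hT, hx, hq0])
  have hdet : LinearMap.det T ≠ 0 := by
    rw [← isUnit_iff_ne_zero]
    exact (LinearEquiv.ofInjectiveEndo T hinj).isUnit_det'
  have hopen : IsOpen {x | q x < 1} := isOpen_lt hqc continuous_const
  have h1 := Measure.addHaar_preimage_linearMap μ hdet {x | q x < 1}
  have hpre : T ⁻¹' {x | q x < 1} = {x | q x < 1} := by
    ext x
    simp [hT]
  have hne : μ {x | q x < 1} ≠ 0 :=
    (hopen.measure_pos μ ⟨0, by simp [hq0]⟩).ne'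
  have htop : μ {x | q x < 1} ≠ ⊤ := hb.measure_lt_top.ne
  have hc : ENNReal.ofReal |(LinearMap.det T)⁻¹| = 1 := by
    rw [hpre] at h1
    exact (ENNReal.mul_eq_right hne htop).1 h1.symm
  refine ⟨(LinearMap.continuous_of_finiteDimensional T).measurable, ?_⟩
  rw [Measure.map_linearMap_addHaar_eq_smul_addHaar μ hdet, hc, one_smul]

namespace RealNormedDivisionAlgebra

variable {F : Type*} [NormedDivisionRing F] [InnerProductSpace ℝ F] [StarRing F]
  [RealNormedDivisionAlgebra F] {m n : ℕ}

theorem eq_inner_smul_one_of_star_eq {x : F} (hx : star x = x) :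
    x = (inner ℝ (1 : F) x) • (1 : F) := by
  have h := add_star_self x
  rw [hx, ← two_smul ℝ, mul_smul] at h
  exact smul_right_injective F two_ne_zero h

variable (F) in
/-- `hermitianOfCoords` as a linear map. -/
def hermitianOfCoordsₗ (m : ℕ) :
    ((Fin m → ℝ) × ({p : Fin m × Fin m // p.1 < p.2} → F)) →ₗ[ℝ] Matrix (Fin m) (Fin m) F where
  toFun := hermitianOfCoords
  map_add' c c' := by
    ext i j
    simp only [hermitianOfCoords, Matrix.of_apply, Matrix.add_apply]
    split_ifs <;> simp [add_smul]
  map_smul' r c := by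
    ext i j
    simp only [hermitianOfCoords, Matrix.of_apply, Matrix.smul_apply]
    split_ifs <;> simp [star_smul_real, mul_smul]

variable (F) in
/-- The diagonal and strictly upper triangular coordinates of a matrix, a left inverse of
`hermitianOfCoords`. -/
def coordsₗ (m : ℕ) : Matrix (Fin m) (Fin m) F →ₗ[ℝ]
    ((Fin m → ℝ) × ({p : Fin m × Fin m // p.1 < p.2} → F)) where
  toFun S := (fun i => inner ℝ (1 : F) (S i i), fun p => S p.1.1 p.1.2)
  map_add' S S' := by ext <;> simp [inner_add_right]
  map_smul' r S := by ext <;> simp [inner_smul_right]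

theorem hermitianOfCoords_coordsₗ {S : Matrix (Fin m) (Fin m) F} (hS : S.IsHermitian) :
    hermitianOfCoords (coordsₗ F m S) = S := by
  ext i j
  simp only [hermitianOfCoords, coordsₗ, Matrix.of_apply, LinearMap.coe_mk, AddHom.coe_mk]
  split_ifs with h h'
  · rfl
  · exact hS.apply i j
  · obtain rfl : i = j := le_antisymm (not_lt.1 h') (not_lt.1 h)
    exact (eq_inner_smul_one_of_star_eq (hS.apply i i)).symm

theorem isHermitian_hermitianOfCoords
    (c : (Fin m → ℝ) × ({p : Fin m × Fin m // p.1 < p.2} → F)) :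
    (hermitianOfCoords c).IsHermitian := by
  ext i j
  simp only [hermitianOfCoords, Matrix.of_apply, Matrix.conjTranspose_apply]
  rcases lt_trichotomy i j with h | rfl | h
  · simp [h, h.not_gt]
  · simp [star_smul_one]
  · simp [h, h.not_gt]

theorem continuous_hermitianOfCoords : Continuous (hermitianOfCoords (F := F) (m := m)) := by
  refine continuous_matrix fun i j => ?_
  unfold hermitianOfCoords
  simp only [Matrix.of_apply]
  split_ifs <;> fun_prop

variable [MeasurableSpace F] [BorelSpace F]

theorem measurePreserving_vecMul {H : Matrix (Fin n) (Fin n) F} (hH : H ∈ unitary _) :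
    MeasurePreserving fun v : Fin n → F => v ᵥ* Hᴴ := by
  have : ProperSpace F := FiniteDimensional.proper_real F
  refine measurePreserving_of_forall_eq volume
    { toFun := fun v => v ᵥ* Hᴴ
      map_add' := fun v w => Matrix.add_vecMul _ v w
      map_smul' := fun c v => Matrix.smul_vecMul c v _ }
    (fun v => ∑ i, ‖v i‖ ^ 2) (by fun_prop) (by simp) (fun x hx => ?_) ?_
    fun x => sum_norm_sq_vecMul hH x
  · rw [Finset.sum_eq_zero_iff_of_nonneg fun i _ => sq_nonneg _] at hx
    ext i
    simpa using hx i (Finset.mem_univ i)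
  · refine Metric.isBounded_closedBall (x := 0) (r := 1) |>.subset fun x hx => ?_
    rw [mem_closedBall_zero_iff, pi_norm_le_iff_of_nonneg zero_le_one]
    intro i
    have := Finset.single_le_sum (f := fun i => ‖x i‖ ^ 2) (fun _ _ => sq_nonneg _)
      (Finset.mem_univ i)
    have hx' : ∑ i, ‖x i‖ ^ 2 < 1 := hx
    nlinarith [norm_nonneg (x i)]

/-- Unitary conjugation preserves the Lebesgue measure on Hermitian matrices, since it preserves
the Frobenius norm. -/
theorem measurePreserving_conj {H : Matrix (Fin m) (Fin m) F} (hH : H ∈ unitary _) :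
    MeasurePreserving (fun S => H * S * Hᴴ) (hermitianVolume F m) (hermitianVolume F m) := by
  have : ProperSpace F := FiniteDimensional.proper_real F
  let K : Matrix (Fin m) (Fin m) F →ₗ[ℝ] Matrix (Fin m) (Fin m) F :=
    { toFun := fun S => H * S * Hᴴ
      map_add' := fun S S' => by rw [mul_add, add_mul]
      map_smul' := fun r S => by
        rw [Matrix.mul_smul, Matrix.smul_mul, RingHom.id_apply] }
  have hmeas : Measurable fun S : Matrix (Fin m) (Fin m) F => H * S * Hᴴ :=
    Continuous.measurable (by fun_prop)
  have hcomm : ∀ c, hermitianOfCoords ((coordsₗ F m ∘ₗ K ∘ₗ hermitianOfCoordsₗ F m) c) =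
      H * hermitianOfCoords c * Hᴴ := fun c => hermitianOfCoords_coordsₗ
    (Matrix.isHermitian_mul_mul_conjTranspose _ (isHermitian_hermitianOfCoords c))
  have hle : ∀ c : (Fin m → ℝ) × ({p : Fin m × Fin m // p.1 < p.2} → F), ∀ i j,
      ‖hermitianOfCoords c i j‖ ^ 2 ≤ ∑ i, ∑ j, ‖hermitianOfCoords c i j‖ ^ 2 := fun c i j =>
    (Finset.single_le_sum (f := fun j => ‖hermitianOfCoords c i j‖ ^ 2)
      (fun _ _ => sq_nonneg _) (Finset.mem_univ j)).trans
    (Finset.single_le_sum (f := fun i => ∑ j, ‖hermitianOfCoords c i j‖ ^ 2)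
      (fun _ _ => Finset.sum_nonneg fun _ _ => sq_nonneg _) (Finset.mem_univ i))
  have hdiag : ∀ (c : (Fin m → ℝ) × ({p : Fin m × Fin m // p.1 < p.2} → F)) (i : Fin m),
      ‖c.1 i‖ = ‖hermitianOfCoords c i i‖ := fun c i => by
    simp [hermitianOfCoords, norm_smul]
  have hoff : ∀ (c : (Fin m → ℝ) × ({p : Fin m × Fin m // p.1 < p.2} → F))
      (p : {p : Fin m × Fin m // p.1 < p.2}),
      ‖c.2 p‖ = ‖hermitianOfCoords c p.1.1 p.1.2‖ := fun c p => by
    simp [hermitianOfCoords, p.2]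
  have hT : MeasurePreserving (coordsₗ F m ∘ₗ K ∘ₗ hermitianOfCoordsₗ F m) := by
    have h1 : (volume : Measure (Fin m → ℝ)).IsAddHaarMeasure := inferInstance
    have h2 : (volume : Measure ({p : Fin m × Fin m // p.1 < p.2} → F)).IsAddHaarMeasure :=
      inferInstance
    have : (volume : Measure ((Fin m → ℝ) ×
        ({p : Fin m × Fin m // p.1 < p.2} → F))).IsAddHaarMeasure :=
      Measure.prod.instIsAddHaarMeasure volume volume
    refine measurePreserving_of_forall_eq volume _
      (fun c => ∑ i, ∑ j, ‖hermitianOfCoords c i j‖ ^ 2) ?_ ?_ (fun c hc => ?_) ?_ fun c => ?_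
    · have := continuous_hermitianOfCoords (F := F) (m := m)
      have h2 : ∀ i j, Continuous fun c => hermitianOfCoords (F := F) (m := m) c i j :=
        fun i j => this.matrix_elem i j
      fun_prop
    · have : hermitianOfCoords (F := F) (m := m) 0 = 0 := map_zero (hermitianOfCoordsₗ F m)
      simp [this]
    · have h0 : ∀ i j, ‖hermitianOfCoords c i j‖ = 0 := fun i j =>
        pow_eq_zero_iff two_ne_zero |>.1 (le_antisymm ((hle c i j).trans_eq hc) (sq_nonneg _))
      refine Prod.ext (funext fun i => ?_) (funext fun p => ?_)
      · exact norm_eq_zero.1 ((hdiag c i).trans (h0 i i))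
      · exact norm_eq_zero.1 ((hoff c p).trans (h0 _ _))
    · refine Metric.isBounded_closedBall (x := 0) (r := 1) |>.subset fun c hc => ?_
      have hc' : ∀ i j, ‖hermitianOfCoords c i j‖ ≤ 1 := fun i j => by
        have h1 : ∑ i, ∑ j, ‖hermitianOfCoords c i j‖ ^ 2 < 1 := hc
        have := hle c i j
        nlinarith [norm_nonneg (hermitianOfCoords c i j)]
      rw [mem_closedBall_zero_iff, Prod.norm_def, max_le_iff,
        pi_norm_le_iff_of_nonneg zero_le_one, pi_norm_le_iff_of_nonneg zero_le_one]
      exact ⟨fun i => (hdiag c i).trans_le (hc' i i), fun p => (hoff c p).trans_le (hc' _ _)⟩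
    · simp only [hcomm]
      exact sum_norm_sq_conj hH _
  refine ⟨hmeas, ?_⟩
  rw [hermitianVolume, Measure.map_map hmeas measurable_hermitianOfCoords]
  conv_rhs => rw [← hT.map_eq, Measure.map_map measurable_hermitianOfCoords hT.measurable]
  congr 1
  ext1 c
  exact (hcomm c).symm

/-! ### Splitting off the first row -/

theorem lintegral_hermitianVolume {φ : Matrix (Fin m) (Fin m) F → ENNReal} (hφ : Measurable φ) :
    ∫⁻ S, φ S ∂hermitianVolume F m = ∫⁻ x : Fin m → ℝ,
      ∫⁻ u : {p : Fin m × Fin m // p.1 < p.2} → F, φ (hermitianOfCoords (x, u)) := by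
  have : ProperSpace F := FiniteDimensional.proper_real F
  rw [hermitianVolume, lintegral_map hφ measurable_hermitianOfCoords, Measure.volume_eq_prod,
    lintegral_prod (fun c => φ (hermitianOfCoords c))
      (hφ.comp measurable_hermitianOfCoords).aemeasurable]

theorem lintegral_upper_succ {g : ({p : Fin (n + 1) × Fin (n + 1) // p.1 < p.2} → F) → ENNReal}
    (hg : Measurable g) : ∫⁻ u, g u = ∫⁻ u : {p : Fin n × Fin n // p.1 < p.2} → F,
      ∫⁻ v : Fin n → F, g fun p => Sum.elim v u ((upperEquiv n).symm p) := by
  have : ProperSpace F := FiniteDimensional.proper_real F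
  have h1 := volume_measurePreserving_piCongrLeft (fun _ => F) (upperEquiv n)
  have h2 := (volume_measurePreserving_sumPiEquivProdPi
    (fun _ : Fin n ⊕ {p : Fin n × Fin n // p.1 < p.2} => F)).symm
  have h3 := h1.comp h2
  rw [← h3.lintegral_comp hg, Measure.volume_eq_prod,
    lintegral_prod_symm (fun z => g ((MeasurableEquiv.piCongrLeft (fun _ => F) (upperEquiv n) ∘
      (MeasurableEquiv.sumPiEquivProdPi fun _ => F).symm) z)) (hg.comp h3.measurable).aemeasurable]
  refine lintegral_congr fun u => lintegral_congr fun v => ?_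
  congr 1
  ext p
  obtain ⟨q, rfl⟩ := (upperEquiv n).surjective p
  rw [Equiv.symm_apply_apply]
  refine (MeasurableEquiv.piCongrLeft_apply_apply (β := fun _ => F) (upperEquiv n) _ q).trans ?_
  rcases q with q | q <;> rfl

/-- Fubini's theorem for the decomposition of a Hermitian matrix into corner, border and block. -/
theorem lintegral_hermitianVolume_succ {φ : Matrix (Fin (n + 1)) (Fin (n + 1)) F → ENNReal}
    (hφ : Measurable φ) :
    ∫⁻ S, φ S ∂hermitianVolume F (n + 1) = ∫⁻ A, (∫⁻ d : ℝ, ∫⁻ v : Fin n → F,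
      φ (borderMat d v A)) ∂hermitianVolume F n := by
  have : ProperSpace F := FiniteDimensional.proper_real F
  have hK : Measurable fun p : ((Matrix (Fin n) (Fin n) F) × ℝ) × (Fin n → F) =>
      φ (borderMat p.1.2 p.2 p.1.1) := hφ.comp (continuous_borderMat.measurable.comp
    (measurable_fst.snd.prodMk (measurable_snd.prodMk measurable_fst.fst)))
  have hK2 : Measurable fun p : (Matrix (Fin n) (Fin n) F) × ℝ =>
      ∫⁻ v : Fin n → F, φ (borderMat p.2 v p.1) := hK.lintegral_prod_right'
  have hK3 : Measurable fun A : (Matrix (Fin n) (Fin n) F) =>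
      ∫⁻ d : ℝ, ∫⁻ v : Fin n → F, φ (borderMat d v A) := hK2.lintegral_prod_right'
  have hH := measurable_hermitianOfCoords (F := F) (m := n)
  have hK4 : Measurable fun p : ((Fin n → ℝ) × ℝ) × ({p : Fin n × Fin n // p.1 < p.2} → F) =>
      ∫⁻ v : Fin n → F, φ (borderMat p.1.2 v (hermitianOfCoords (p.1.1, p.2))) :=
    hK2.comp ((hH.comp (measurable_fst.fst.prodMk measurable_snd)).prodMk measurable_fst.snd)
  have hφ' : Measurable fun p => φ (hermitianOfCoords (F := F) (m := n + 1) p) :=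
    hφ.comp measurable_hermitianOfCoords
  rw [lintegral_hermitianVolume hφ, lintegral_hermitianVolume hK3, volume_pi,
    lintegral_pi_fin_succ _ hφ'.lintegral_prod_right']
  have e : ∀ (d : ℝ) (x : Fin n → ℝ),
      ∫⁻ u, φ (hermitianOfCoords (F := F) (m := n + 1) (Fin.cons d x, u)) =
        ∫⁻ u, ∫⁻ v : Fin n → F, φ (borderMat d v (hermitianOfCoords (x, u))) := by
    intro d x
    rw [lintegral_upper_succ (g := fun u => φ (hermitianOfCoords (Fin.cons d x, u)))
      (hφ'.comp measurable_prodMk_left)]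
    simp only [hermitianOfCoords_succ]
  simp only [e]
  rw [lintegral_lintegral_swap]
  · refine lintegral_congr fun x => ?_
    rw [lintegral_lintegral_swap]
    exact (hK4.comp ((measurable_const.prodMk measurable_fst).prodMk measurable_snd)).aemeasurable
  · exact (hK4.lintegral_prod_right'.comp measurable_swap).aemeasurable

end RealNormedDivisionAlgebra

/-! ### Polar coordinates -/

section Polar

variable {E : Type*} [NormedAddCommGroup E] [InnerProductSpace ℝ E] [FiniteDimensional ℝ E]
  [MeasurableSpace E] [BorelSpace E] [Nontrivial E]

/-- Integration in polar coordinates for nonnegative radial functions. -/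
theorem lintegral_fun_norm_addHaar (μ : Measure E) [μ.IsAddHaarMeasure] {g : ℝ → ENNReal}
    (hg : Measurable g) : ∫⁻ x, g ‖x‖ ∂μ = Module.finrank ℝ E * μ (Metric.ball 0 1) *
      ∫⁻ y in Set.Ioi (0 : ℝ), ENNReal.ofReal (y ^ (Module.finrank ℝ E - 1)) * g y := by
  have hmp := μ.measurePreserving_homeomorphUnitSphereProd
  calc
    ∫⁻ x, g ‖x‖ ∂μ = ∫⁻ x : ({(0)}ᶜ : Set E), g ‖x.1‖ ∂(μ.comap (↑)) := by
      rw [lintegral_subtype_comap (measurableSet_singleton _).compl fun x => g ‖x‖,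
        restrict_compl_singleton]
    _ = ∫⁻ x, g x.2 ∂μ.toSphere.prod (.volumeIoiPow (Module.finrank ℝ E - 1)) := by
      rw [← hmp.lintegral_comp (f := fun x => g x.2) (hg.comp measurable_snd.subtype_val)]
      simp
    _ = μ.toSphere Set.univ *
        ∫⁻ x : Set.Ioi (0 : ℝ), g x ∂.volumeIoiPow (Module.finrank ℝ E - 1) := by
      rw [lintegral_prod (fun x : Metric.sphere (0 : E) 1 × Set.Ioi (0 : ℝ) => g x.2)
        (hg.comp measurable_snd.subtype_val).aemeasurable,
        mul_comm]
      exact lintegral_const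
        (∫⁻ y : Set.Ioi (0 : ℝ), g y ∂.volumeIoiPow (Module.finrank ℝ E - 1))
    _ = _ := by
      rw [Measure.volumeIoiPow, lintegral_withDensity_eq_lintegral_mul _ (by fun_prop)
        (show Measurable fun x : Set.Ioi (0 : ℝ) => g x from hg.comp measurable_subtype_coe),
        μ.toSphere_apply_univ]
      congr 1
      exact lintegral_subtype_comap measurableSet_Ioi
        fun y : ℝ => ENNReal.ofReal (y ^ (Module.finrank ℝ E - 1)) * g y

/-- The density `π ^ (β / 2) / Γ (β / 2) * r ^ (β / 2 - 1)` of the squared norm in a Euclidean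
space of dimension `β`. -/
noncomputable def normSqDensity (β : ℕ) (r : ℝ) : ℝ :=
  Real.pi ^ ((β : ℝ) / 2) / Real.Gamma ((β : ℝ) / 2) * r ^ ((β : ℝ) / 2 - 1)

theorem measurable_normSqDensity (β : ℕ) : Measurable (normSqDensity β) := by
  unfold normSqDensity
  fun_prop

theorem lintegral_fun_norm_sq {g : ℝ → ENNReal} (hg : Measurable g) :
    ∫⁻ x : E, g (‖x‖ ^ 2) = ∫⁻ r in Set.Ioi (0 : ℝ),
      ENNReal.ofReal (normSqDensity (Module.finrank ℝ E) r) * g r := by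
  have hpos : 0 < Module.finrank ℝ E := Module.finrank_pos
  set b := Module.finrank ℝ E with hb
  have hb0 : (0 : ℝ) < b := Nat.cast_pos.2 hpos
  have hG : 0 < Real.Gamma ((b : ℝ) / 2) := Real.Gamma_pos_of_pos (by positivity)
  have himg : (fun y : ℝ => y ^ 2) '' Set.Ioi 0 = Set.Ioi 0 := by
    ext r
    constructor
    · rintro ⟨y, hy, rfl⟩
      exact pow_pos (Set.mem_Ioi.1 hy) 2
    · intro hr
      exact ⟨√r, Real.sqrt_pos.2 hr, Real.sq_sqrt (le_of_lt hr)⟩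
  conv_rhs => rw [← himg]
  rw [lintegral_image_eq_lintegral_abs_deriv_mul (f' := fun y => 2 * y) measurableSet_Ioi
    (fun y _ => by simpa using (hasDerivAt_pow 2 y).hasDerivWithinAt)
    (fun y hy z hz h => (sq_eq_sq₀ (le_of_lt hy) (le_of_lt hz)).1 h),
    lintegral_fun_norm_addHaar (g := fun y => g (y ^ 2)) volume
      (hg.comp (measurable_id.pow_const 2)), ← hb,
    InnerProductSpace.volume_ball, ← lintegral_const_mul _ (by fun_prop)]
  refine setLIntegral_congr_fun measurableSet_Ioi fun y hy => ?_
  have hy : 0 < y := hy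
  rw [abs_of_pos (by positivity), ← mul_assoc (ENNReal.ofReal (2 * y)),
    ← mul_assoc (_ * _) (ENNReal.ofReal (y ^ (b - 1))), ← hb]
  congr 1
  rw [ENNReal.ofReal_one, one_pow, one_mul, ← ENNReal.ofReal_natCast,
    ← ENNReal.ofReal_mul hb0.le, ← ENNReal.ofReal_mul, ← ENNReal.ofReal_mul (by positivity)]
  · congr 1
    have h1 : √Real.pi ^ b = Real.pi ^ ((b : ℝ) / 2) := by
      rw [Real.sqrt_eq_rpow, ← Real.rpow_natCast, ← Real.rpow_mul Real.pi_pos.le]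
      congr 1
      ring
    have h2 : (y ^ 2) ^ ((b : ℝ) / 2 - 1) * y = y ^ (b - 1) := by
      rw [← Real.rpow_natCast y 2, ← Real.rpow_mul hy.le]
      nth_rewrite 2 [← Real.rpow_one y]
      rw [← Real.rpow_add hy, ← Real.rpow_natCast, Nat.cast_sub hpos]
      congr 1
      push_cast
      ring
    rw [normSqDensity, h1, Real.Gamma_add_one (by positivity), ← h2]
    field_simp
  · have := Real.Gamma_pos_of_pos (show (0 : ℝ) < b / 2 + 1 by positivity)
    positivity

theorem map_norm_sq_volume : (volume : Measure E).map (fun x => ‖x‖ ^ 2) =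
    (volume.restrict (Set.Ioi (0 : ℝ))).withDensity
      fun r => ENNReal.ofReal (normSqDensity (Module.finrank ℝ E) r) := by
  have hm : Measurable fun x : E => ‖x‖ ^ 2 := by fun_prop
  ext s hs
  rw [← lintegral_indicator_one hs, lintegral_map (measurable_one.indicator hs) hm,
    lintegral_fun_norm_sq (measurable_one.indicator hs), withDensity_apply _ hs,
    ← lintegral_indicator hs]
  refine lintegral_congr fun r => ?_
  by_cases hr : r ∈ s <;> simp [hr]

theorem lintegral_pi_norm_sq {n : ℕ} {G : (Fin n → ℝ) → ENNReal} (hG : Measurable G) :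
    ∫⁻ v : Fin n → E, G (fun i => ‖v i‖ ^ 2) = ∫⁻ r in Set.univ.pi fun _ => Set.Ioi (0 : ℝ),
      (∏ i, ENNReal.ofReal (normSqDensity (Module.finrank ℝ E) (r i))) * G r := by
  have hm : Measurable fun x : E => ‖x‖ ^ 2 := by fun_prop
  have hd := measurable_normSqDensity (Module.finrank ℝ E)
  have hsf : SigmaFinite ((volume.restrict (Set.Ioi (0 : ℝ))).withDensity
      fun r => ENNReal.ofReal (normSqDensity (Module.finrank ℝ E) r)) :=
    SigmaFinite.withDensity_ofReal _
  have hmp : MeasurePreserving (fun x : E => ‖x‖ ^ 2) volume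
      ((volume.restrict (Set.Ioi (0 : ℝ))).withDensity
        fun r => ENNReal.ofReal (normSqDensity (Module.finrank ℝ E) r)) :=
    ⟨hm, map_norm_sq_volume⟩
  have hmp2 := measurePreserving_pi (fun _ : Fin n => (volume : Measure E)) _ fun _ => hmp
  rw [volume_pi, hmp2.lintegral_comp hG, pi_withDensity _ (by fun_prop),
    lintegral_withDensity_eq_lintegral_mul _ (by fun_prop) hG, volume_pi,
    Measure.restrict_pi_pi]
  rfl

end Polar

/-! ### Integration of unitarily invariant functions -/

/-- The normalising constant of the eigenvalue density, as the product of the constants that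
arise when the rows of the matrix are split off one at a time. -/
noncomputable def eigenConst (β m : ℕ) : ℝ :=
  ∏ k ∈ Finset.range m, Real.pi ^ ((β : ℝ) * k / 2) * Real.Gamma ((β : ℝ) / 2) /
    Real.Gamma (((k : ℝ) + 1) * ((β : ℝ) / 2))

theorem eigenConst_pos {β : ℕ} (hβ : 0 < β) (m : ℕ) : 0 < eigenConst β m := by
  have hb : (0 : ℝ) < β := Nat.cast_pos.2 hβ
  refine Finset.prod_pos fun k _ => ?_
  have h1 := Real.Gamma_pos_of_pos (show (0 : ℝ) < (β : ℝ) / 2 by positivity)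
  have h2 := Real.Gamma_pos_of_pos (show (0 : ℝ) < ((k : ℝ) + 1) * ((β : ℝ) / 2) by positivity)
  positivity

theorem measurable_vandermondeProd {n : ℕ} : Measurable (vandermondeProd : (Fin n → ℝ) → ℝ) :=
  continuous_vandermondeProd.measurable

theorem isOpen_setOf_strictAnti {n : ℕ} : IsOpen {l : Fin n → ℝ | StrictAnti l} := by
  cases n with
  | zero =>
    convert isOpen_univ
    exact Set.eq_univ_of_forall fun l i => i.elim0
  | succ n =>
    simp only [Fin.strictAnti_iff_succ_lt, Set.ofPred_forall]
    exact isOpen_iInter_of_finite fun i => isOpen_lt (by fun_prop) (by fun_prop)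

/-- The joint density of the diagonal `a` of an arrowhead matrix and its eigenvalues `l`, with the
Jacobian and the densities of the border multiplied out. -/
theorem arrowDensity_eq {n β : ℕ} (hβ : 0 < β) {a : Fin n → ℝ} {l : Fin (n + 1) → ℝ}
    (h : Interlace a l) :
    ENNReal.ofReal (vandermondeProd a ^ β) *
        ENNReal.ofReal (vandermondeProd l / vandermondeProd a) *
          ∏ i : Fin n, ENNReal.ofReal (normSqDensity β (arrowParams a l i.succ)) =
      ENNReal.ofReal ((Real.pi ^ ((β : ℝ) / 2) / Real.Gamma ((β : ℝ) / 2)) ^ n *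
          vandermondeProd l) *
        ENNReal.ofReal (vandermondeProd a *
          (∏ i, ∏ j, |l j - a i|) ^ ((β : ℝ) / 2 - 1)) := by
  have hb : (0 : ℝ) < β := Nat.cast_pos.2 hβ
  have hG : 0 < Real.Gamma ((β : ℝ) / 2) := Real.Gamma_pos_of_pos (by positivity)
  set c : ℝ := (Real.pi ^ ((β : ℝ) / 2) / Real.Gamma ((β : ℝ) / 2)) ^ n with hc
  have hc0 : 0 < c := by positivity
  have hva := vandermondeProd_pos h.strictAnti_left
  have hvl := vandermondeProd_pos h.strictAnti_right
  have hr : ∀ i : Fin n, 0 < arrowParams a l i.succ := arrowParams_succ_pos h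
  have hP : 0 < ∏ i, ∏ j, |l j - a i| := Finset.prod_pos fun i _ =>
    Finset.prod_pos fun j _ => abs_pos.2 (h.sub_ne_zero i j)
  have hd : ∀ i : Fin n, 0 ≤ normSqDensity β (arrowParams a l i.succ) := fun i => by
    have := hr i
    unfold normSqDensity
    positivity
  have e1 : ∏ i : Fin n, normSqDensity β (arrowParams a l i.succ) =
      c * ((∏ i, ∏ j, |l j - a i|) / vandermondeProd a ^ 2) ^ ((β : ℝ) / 2 - 1) := by
    simp only [normSqDensity]
    rw [Finset.prod_mul_distrib, Finset.prod_const, Finset.card_univ, Fintype.card_fin,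
      Real.finsetProd_rpow _ _ fun i _ => (hr i).le, ← abs_prod_arrowParams,
      abs_of_pos (Finset.prod_pos fun i _ => hr i)]
  have e2 : vandermondeProd a ^ β * (vandermondeProd a)⁻¹ *
      ((vandermondeProd a ^ 2) ^ ((β : ℝ) / 2 - 1))⁻¹ = vandermondeProd a := by
    rw [← Real.rpow_natCast, ← Real.rpow_natCast, ← Real.rpow_mul hva.le,
      ← Real.rpow_neg hva.le, ← Real.rpow_neg_one, ← Real.rpow_add hva, ← Real.rpow_add hva]
    conv_rhs => rw [← Real.rpow_one (vandermondeProd a)]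
    congr 1
    push_cast
    ring
  rw [← ENNReal.ofReal_prod_of_nonneg fun i _ => hd i, e1, ← ENNReal.ofReal_mul (by positivity),
    ← ENNReal.ofReal_mul (by positivity), ← ENNReal.ofReal_mul (by positivity)]
  congr 1
  rw [Real.div_rpow hP.le (by positivity)]
  nth_rewrite 4 [← e2]
  simp only [div_eq_mul_inv]
  ring

/-- Integrating out the diagonal of an arrowhead matrix, for fixed eigenvalues. -/
theorem lintegral_interlace {n β : ℕ} (hβ : 0 < β) (g : (Fin (n + 1) → ℝ) → ENNReal)
    (hg : Measurable g) :
    ∫⁻ a in {a : Fin n → ℝ | StrictAnti a}, ENNReal.ofReal (vandermondeProd a ^ β) *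
      ∫⁻ l in {l : Fin (n + 1) → ℝ | Interlace a l},
        ENNReal.ofReal (vandermondeProd l / vandermondeProd a) *
          ((∏ i : Fin n, ENNReal.ofReal (normSqDensity β (arrowParams a l i.succ))) * g l) =
    ENNReal.ofReal (Real.pi ^ ((β : ℝ) * n / 2) * Real.Gamma ((β : ℝ) / 2) /
      Real.Gamma (((n : ℝ) + 1) * ((β : ℝ) / 2))) *
        ∫⁻ l in {l : Fin (n + 1) → ℝ | StrictAnti l},
          ENNReal.ofReal (vandermondeProd l ^ β) * g l := by
  have hb : (0 : ℝ) < β := Nat.cast_pos.2 hβ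
  have hG : 0 < Real.Gamma ((β : ℝ) / 2) := Real.Gamma_pos_of_pos (by positivity)
  have hG2 : 0 < Real.Gamma (((n : ℝ) + 1) * ((β : ℝ) / 2)) :=
    Real.Gamma_pos_of_pos (by positivity)
  have hmI : MeasurableSet {p : (Fin n → ℝ) × (Fin (n + 1) → ℝ) | Interlace p.1 p.2} :=
    isOpen_setOf_interlace.measurableSet
  have hmSA : ∀ k, MeasurableSet {l : Fin k → ℝ | StrictAnti l} := fun k =>
    isOpen_setOf_strictAnti.measurableSet
  set c : ℝ := (Real.pi ^ ((β : ℝ) / 2) / Real.Gamma ((β : ℝ) / 2)) ^ n with hc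
  have hc0 : 0 < c := by positivity
  set w : (Fin n → ℝ) → (Fin (n + 1) → ℝ) → ENNReal := fun a l =>
    ENNReal.ofReal (vandermondeProd a * (∏ i, ∏ j, |l j - a i|) ^ ((β : ℝ) / 2 - 1)) with hw
  set K : (Fin n → ℝ) × (Fin (n + 1) → ℝ) → ENNReal :=
    {p : (Fin n → ℝ) × (Fin (n + 1) → ℝ) | Interlace p.1 p.2}.indicator fun p =>
      ENNReal.ofReal (c * vandermondeProd p.2) * g p.2 * w p.1 p.2 with hK
  have hv := measurable_vandermondeProd (n := n)
  have hv' := measurable_vandermondeProd (n := n + 1)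
  have hwm : Measurable fun p : (Fin n → ℝ) × (Fin (n + 1) → ℝ) => w p.1 p.2 := by
    simp only [hw]
    fun_prop
  have hKm : Measurable K := Measurable.indicator (by fun_prop) hmI
  have hpt : ∀ (a : Fin n → ℝ) (l : Fin (n + 1) → ℝ), Interlace a l →
      ENNReal.ofReal (vandermondeProd a ^ β) *
        (ENNReal.ofReal (vandermondeProd l / vandermondeProd a) *
          ((∏ i : Fin n, ENNReal.ofReal (normSqDensity β (arrowParams a l i.succ))) * g l)) =
      ENNReal.ofReal (c * vandermondeProd l) * g l * w a l := fun a l h => by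
    rw [← mul_assoc, ← mul_assoc, arrowDensity_eq hβ h, mul_right_comm]
  have h1 : ∫⁻ a in {a : Fin n → ℝ | StrictAnti a}, ENNReal.ofReal (vandermondeProd a ^ β) *
      ∫⁻ l in {l : Fin (n + 1) → ℝ | Interlace a l},
        ENNReal.ofReal (vandermondeProd l / vandermondeProd a) *
          ((∏ i : Fin n, ENNReal.ofReal (normSqDensity β (arrowParams a l i.succ))) * g l) =
      ∫⁻ a, ∫⁻ l, K (a, l) := by
    rw [← lintegral_indicator (hmSA n)]
    refine lintegral_congr fun a => ?_
    have hmIa : MeasurableSet {l : Fin (n + 1) → ℝ | Interlace a l} :=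
      hmI.preimage measurable_prodMk_left
    by_cases ha : StrictAnti a
    · rw [Set.indicator_of_mem (by exact ha), ← lintegral_const_mul' _ _ ENNReal.ofReal_ne_top,
        setLIntegral_congr_fun hmIa fun l hl => hpt a l hl, ← lintegral_indicator hmIa]
      rfl
    · rw [Set.indicator_of_notMem (by exact ha)]
      refine (lintegral_eq_zero_of_ae_eq_zero (Filter.Eventually.of_forall fun l => ?_)).symm
      exact Set.indicator_of_notMem (fun h => ha (Interlace.strictAnti_left h)) _
  have h2 : ∀ l, ∫⁻ a, K (a, l) = {l : Fin (n + 1) → ℝ | StrictAnti l}.indicator (fun l =>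
      ENNReal.ofReal (Real.pi ^ ((β : ℝ) * n / 2) * Real.Gamma ((β : ℝ) / 2) /
        Real.Gamma (((n : ℝ) + 1) * ((β : ℝ) / 2))) *
          (ENNReal.ofReal (vandermondeProd l ^ β) * g l)) l := by
    intro l
    have hmIl : MeasurableSet {a : Fin n → ℝ | Interlace a l} :=
      hmI.preimage measurable_prodMk_right
    by_cases hl : StrictAnti l
    · have hvl := vandermondeProd_pos hl
      have hwl : Measurable fun a => w a l := by
        simp only [hw]
        fun_prop
      have hKa : ∀ a, K (a, l) = {a : Fin n → ℝ | Interlace a l}.indicator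
          (fun a => ENNReal.ofReal (c * vandermondeProd l) * g l * w a l) a := fun a => by
        by_cases h : Interlace a l
        · rw [Set.indicator_of_mem (by exact h)]
          exact Set.indicator_of_mem (by exact h) _
        · rw [Set.indicator_of_notMem (by exact h)]
          exact Set.indicator_of_notMem (by exact h) _
      have e : ∫⁻ a, K (a, l) = ENNReal.ofReal (c * vandermondeProd l) * g l *
          ∫⁻ a in {a : Fin n → ℝ | Interlace a l}, w a l := by
        rw [lintegral_congr hKa, lintegral_indicator hmIl]
        exact lintegral_const_mul (ENNReal.ofReal (c * vandermondeProd l) * g l) hwl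
      rw [e, Set.indicator_of_mem (by exact hl), hw,
        lintegral_dixonAnderson hl (show (0 : ℝ) < (β : ℝ) / 2 by positivity), mul_right_comm,
        ← mul_assoc, ← ENNReal.ofReal_mul (by positivity), ← ENNReal.ofReal_mul (by positivity)]
      congr 2
      have e3 : vandermondeProd l * vandermondeProd l ^ (2 * ((β : ℝ) / 2) - 1) =
          vandermondeProd l ^ β := by
        nth_rewrite 1 [← Real.rpow_one (vandermondeProd l)]
        rw [← Real.rpow_add hvl, ← Real.rpow_natCast]
        congr 1
        ring
      have e4 : (Real.pi ^ ((β : ℝ) / 2)) ^ n = Real.pi ^ ((β : ℝ) * n / 2) := by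
        rw [← Real.rpow_natCast, ← Real.rpow_mul Real.pi_pos.le]
        congr 1
        ring
      rw [← e3, hc, div_pow, e4, pow_succ]
      field_simp
    · rw [Set.indicator_of_notMem (by exact hl)]
      refine lintegral_eq_zero_of_ae_eq_zero (Filter.Eventually.of_forall fun a => ?_)
      exact Set.indicator_of_notMem (fun h => hl (Interlace.strictAnti_right h)) _
  rw [h1, lintegral_lintegral_swap (f := fun a l => K (a, l)) hKm.aemeasurable]
  simp only [h2]
  rw [lintegral_indicator (hmSA _), lintegral_const_mul' _ _ ENNReal.ofReal_ne_top]

namespace RealNormedDivisionAlgebra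

theorem continuous_realDiagonal {F : Type*} [NormedDivisionRing F] [InnerProductSpace ℝ F]
    {m : ℕ} : Continuous (realDiagonal F : (Fin m → ℝ) → Matrix (Fin m) (Fin m) F) := by
  unfold realDiagonal
  exact Continuous.matrix_diagonal (by fun_prop)

variable {F : Type*} [NormedDivisionRing F] [InnerProductSpace ℝ F] [StarRing F]
  [RealNormedDivisionAlgebra F] [MeasurableSpace F] [BorelSpace F] {m n : ℕ}

/-- The integral over corner and border of an arrowhead matrix, in terms of its eigenvalues. -/
theorem lintegral_borderMat_realDiagonal {a : Fin n → ℝ} (ha : StrictAnti a)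
    {φ : Matrix (Fin (n + 1)) (Fin (n + 1)) F → ENNReal} (hφ : Measurable φ)
    (hinv : ∀ H ∈ unitary (Matrix (Fin (n + 1)) (Fin (n + 1)) F), ∀ S, φ (H * S * Hᴴ) = φ S) :
    ∫⁻ d : ℝ, ∫⁻ v : Fin n → F, φ (borderMat d v (realDiagonal F a)) =
      ∫⁻ l in {l : Fin (n + 1) → ℝ | Interlace a l},
        ENNReal.ofReal (vandermondeProd l / vandermondeProd a) *
          ((∏ i : Fin n, ENNReal.ofReal (normSqDensity (Module.finrank ℝ F)
            (arrowParams a l i.succ))) * φ (realDiagonal F l)) := by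
  have : ProperSpace F := FiniteDimensional.proper_real F
  have hposm : MeasurableSet {c : Fin (n + 1) → ℝ | ∀ i : Fin n, 0 < c i.succ} := by
    simp only [Set.ofPred_forall]
    exact MeasurableSet.iInter fun i => measurableSet_lt measurable_const (measurable_pi_apply _)
  have hIm : MeasurableSet {l : Fin (n + 1) → ℝ | Interlace a l} :=
    (isOpen_setOf_interlace.preimage (Continuous.prodMk_right a)).measurableSet
  -- invariance allows the border to be replaced by the moduli of its entries
  set g : (Fin (n + 1) → ℝ) → ENNReal := fun c =>
    φ (borderMat (c 0) (fun i => √(c i.succ) • (1 : F)) (realDiagonal F a)) with hg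
  have hgm : Measurable g := by
    refine hφ.comp (continuous_borderMat.comp (Continuous.prodMk (continuous_apply 0)
      (Continuous.prodMk ?_ continuous_const))).measurable
    exact continuous_pi fun i => (Real.continuous_sqrt.comp (continuous_apply _)).smul
      continuous_const
  have key : ∀ {d : ℝ} {v : Fin n → F} {l : Fin (n + 1) → ℝ}, Interlace a l →
      arrowParams a l = Fin.cons d (fun i => ‖v i‖ ^ 2) →
      φ (borderMat d v (realDiagonal F a)) = φ (realDiagonal F l) := by
    intro d v l hl hd
    obtain ⟨H, hH⟩ := exists_unitary_borderMat_eq (F := F) hl hd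
    rw [hH, hinv _ H.2]
  have hgl : ∀ l, Interlace a l → g (arrowParams a l) = φ (realDiagonal F l) := by
    intro l hl
    refine key hl ?_
    rw [← Fin.cons_self_tail (arrowParams a l)]
    congr 1
    ext i
    rw [norm_smul, norm_one, mul_one, Real.norm_eq_abs, sq_abs]
    exact (Real.sq_sqrt (arrowParams_succ_pos hl i).le).symm
  have hgv : ∀ (d : ℝ) (v : Fin n → F), (∀ i, v i ≠ 0) →
      φ (borderMat d v (realDiagonal F a)) = g (Fin.cons d fun i => ‖v i‖ ^ 2) := by
    intro d v hv
    obtain ⟨l, hl, hlc⟩ := exists_interlace_arrowParams_eq ha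
      (c := Fin.cons d fun i => ‖v i‖ ^ 2) fun i => by
        rw [Fin.cons_succ]
        exact pow_pos (norm_pos_iff.2 (hv i)) 2
    rw [key hl hlc, ← hgl l hl, hlc]
  have hae : ∀ᵐ v : Fin n → F, ∀ i, v i ≠ 0 := by
    rw [ae_all_iff]
    intro i
    have h0 : ∀ᵐ x : F, x ≠ 0 := by
      rw [ae_iff]
      simp
    exact (Measure.quasiMeasurePreserving_eval (fun _ : Fin n => (volume : Measure F)) i).ae h0
  have h1 : ∀ d : ℝ, ∫⁻ v : Fin n → F, φ (borderMat d v (realDiagonal F a)) =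
      ∫⁻ r in Set.univ.pi fun _ : Fin n => Set.Ioi (0 : ℝ),
        (∏ i, ENNReal.ofReal (normSqDensity (Module.finrank ℝ F) (r i))) * g (Fin.cons d r) := by
    intro d
    rw [lintegral_congr_ae (hae.mono fun v hv => hgv d v hv)]
    refine lintegral_pi_norm_sq (G := fun r => g (Fin.cons d r)) (hgm.comp ?_)
    exact (continuous_pi fun i => Fin.cases (by simpa using continuous_const)
      (fun i => by simpa using continuous_apply i) i).measurable
  have hdm := measurable_normSqDensity (Module.finrank ℝ F)
  have h2 : ∫⁻ d : ℝ, ∫⁻ v : Fin n → F, φ (borderMat d v (realDiagonal F a)) =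
      ∫⁻ c in {c : Fin (n + 1) → ℝ | ∀ i : Fin n, 0 < c i.succ},
        (∏ i : Fin n, ENNReal.ofReal (normSqDensity (Module.finrank ℝ F) (c i.succ))) * g c := by
    rw [← lintegral_indicator hposm]
    refine Eq.trans ?_ (lintegral_pi_fin_succ volume (Measurable.indicator
      (Measurable.mul (f := fun c : Fin (n + 1) → ℝ => ∏ i : Fin n,
        ENNReal.ofReal (normSqDensity (Module.finrank ℝ F) (c i.succ))) (by fun_prop) hgm)
      hposm)).symm
    refine lintegral_congr fun d => ?_
    rw [h1, ← lintegral_indicator (MeasurableSet.univ_pi fun _ => measurableSet_Ioi)]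
    refine lintegral_congr fun r => ?_
    by_cases hr : ∀ i, 0 < r i
    · rw [Set.indicator_of_mem (by exact fun i _ => hr i),
        Set.indicator_of_mem (by exact fun i => by simpa using hr i)]
      simp
    · rw [Set.indicator_of_notMem (by exact fun h => hr fun i => h i trivial),
        Set.indicator_of_notMem (by exact fun h => hr fun i => by simpa using h i)]
  rw [h2, lintegral_arrowParams ha]
  exact setLIntegral_congr_fun hIm fun l hl => by rw [hgl l hl]

/-- Weyl's integration formula for unitarily invariant functions. The proof is by induction on the
size: the lower right block may be diagonalised, and the eigenvalues of the resulting arrowhead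
matrix are integrated against those of the block by the Dixon–Anderson integral. -/
theorem lintegral_hermitianVolume_of_invariant
    {φ : Matrix (Fin m) (Fin m) F → ENNReal} (hφ : Measurable φ)
    (hinv : ∀ H ∈ unitary (Matrix (Fin m) (Fin m) F), ∀ S, φ (H * S * Hᴴ) = φ S) :
    ∫⁻ S, φ S ∂hermitianVolume F m = ENNReal.ofReal (eigenConst (Module.finrank ℝ F) m) *
      ∫⁻ l in {l : Fin m → ℝ | StrictAnti l},
        ENNReal.ofReal (vandermondeProd l ^ Module.finrank ℝ F) * φ (realDiagonal F l) := by
  have : ProperSpace F := FiniteDimensional.proper_real F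
  induction m with
  | zero =>
    have hS : ∀ S : Matrix (Fin 0) (Fin 0) F, φ S = φ 0 := fun S =>
      congrArg φ (Subsingleton.elim _ _)
    have hu : {l : Fin 0 → ℝ | StrictAnti l} = Set.univ :=
      Set.eq_univ_of_forall fun l i => i.elim0
    rw [lintegral_hermitianVolume hφ, hu]
    simp only [hS]
    simp [eigenConst, vandermondeProd, volume_pi]
  | succ n ih =>
    have hK : Measurable fun p : ((Matrix (Fin n) (Fin n) F) × ℝ) × (Fin n → F) =>
        φ (borderMat p.1.2 p.2 p.1.1) := hφ.comp (continuous_borderMat.measurable.comp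
      (measurable_fst.snd.prodMk (measurable_snd.prodMk measurable_fst.fst)))
    have hΦ : Measurable fun A : (Matrix (Fin n) (Fin n) F) =>
        ∫⁻ d : ℝ, ∫⁻ v : Fin n → F, φ (borderMat d v A) :=
      hK.lintegral_prod_right'.lintegral_prod_right'
    have hΦinv : ∀ H ∈ unitary (Matrix (Fin n) (Fin n) F), ∀ A,
        ∫⁻ d : ℝ, ∫⁻ v : Fin n → F, φ (borderMat d v (H * A * Hᴴ)) =
          ∫⁻ d : ℝ, ∫⁻ v : Fin n → F, φ (borderMat d v A) := by
      intro H hH A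
      refine lintegral_congr fun d => ?_
      rw [← (measurePreserving_vecMul hH).lintegral_comp (f := fun v =>
        φ (borderMat d v (H * A * Hᴴ)))]
      · refine lintegral_congr fun v => ?_
        rw [← borderMat_conj, hinv _ (borderMat_one_mem_unitary hH)]
      · exact hφ.comp (continuous_borderMat.measurable.comp
          (measurable_const.prodMk (measurable_id.prodMk measurable_const)))
    rw [lintegral_hermitianVolume_succ hφ, ih hΦ hΦinv]
    have h1 : ∀ a ∈ {a : Fin n → ℝ | StrictAnti a},
        ENNReal.ofReal (vandermondeProd a ^ Module.finrank ℝ F) *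
          ∫⁻ d : ℝ, ∫⁻ v : Fin n → F, φ (borderMat d v (realDiagonal F a)) = _ := fun a ha => by
      rw [lintegral_borderMat_realDiagonal ha hφ hinv]
    rw [setLIntegral_congr_fun isOpen_setOf_strictAnti.measurableSet h1,
      lintegral_interlace (Module.finrank_pos (R := ℝ) (M := F)) (fun l => φ (realDiagonal F l))
        (hφ.comp continuous_realDiagonal.measurable),
      ← mul_assoc, ← ENNReal.ofReal_mul (eigenConst_pos Module.finrank_pos n).le,
      eigenConst, eigenConst, Finset.prod_range_succ]

end RealNormedDivisionAlgebra

/-! ### The normalising constant -/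

theorem prod_range_rpow_eq (p : ℝ) (hp : 0 < p) (b : ℝ) (m : ℕ) :
    ∏ k ∈ Finset.range m, p ^ (b * k / 2) = p ^ ((m : ℝ) * ((m : ℝ) - 1) * b / 4) := by
  induction m with
  | zero => simp
  | succ m ih =>
    rw [Finset.prod_range_succ, ih, ← Real.rpow_add hp]
    congr 1
    push_cast
    ring

/-- The exponent `ϱ` accounts for the differences between `Γ(1/2) = √π`, `Γ(1) = 1` and
`Γ(2) = 1`. -/
theorem Gamma_half_pow_eq {β : ℕ} (hβ : β = 1 ∨ β = 2 ∨ β = 4) (m : ℕ) :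
    Real.Gamma ((β : ℝ) / 2) ^ m = Real.pi ^ ((m : ℝ) * (β : ℝ) / 2 + varrho β m) := by
  rcases hβ with rfl | rfl | rfl
  · rw [Nat.cast_one, Real.Gamma_one_half_eq, Real.sqrt_eq_rpow, ← Real.rpow_natCast,
      ← Real.rpow_mul Real.pi_pos.le]
    congr 1
    simp [varrho]
    ring
  · have : (m : ℝ) * ((2 : ℕ) : ℝ) / 2 + varrho 2 m = 0 := by
      simp [varrho]
    rw [this]
    simp
  · have h1 : (m : ℝ) * ((4 : ℕ) : ℝ) / 2 + varrho 4 m = 0 := by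
      simp [varrho]
      ring
    have h2 : ((4 : ℕ) : ℝ) / 2 = 2 := by norm_num
    rw [h1, h2, Real.Gamma_two]
    simp

theorem eigenConst_eq {β : ℕ} (hβ : β = 1 ∨ β = 2 ∨ β = 4) (m : ℕ) :
    eigenConst β m = Real.pi ^ ((m : ℝ) ^ 2 * (β : ℝ) / 2 + varrho β m) /
      multivariateGamma β m ((m : ℝ) * (β : ℝ) / 2) := by
  have h1 : ∏ i : Fin m, Real.Gamma ((m : ℝ) * (β : ℝ) / 2 - (i : ℝ) * (β : ℝ) / 2) =
      ∏ k ∈ Finset.range m, Real.Gamma (((k : ℝ) + 1) * ((β : ℝ) / 2)) := by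
    rw [← Finset.prod_range_reflect, Fin.prod_univ_eq_prod_range
      (fun i : ℕ => Real.Gamma ((m : ℝ) * (β : ℝ) / 2 - (i : ℝ) * (β : ℝ) / 2)) m]
    refine Finset.prod_congr rfl fun i hi => ?_
    have hi' : i + 1 ≤ m := Finset.mem_range.1 hi
    rw [Nat.sub_sub, add_comm 1 i, Nat.cast_sub hi']
    congr 1
    push_cast
    ring
  have hpi := Real.pi_pos
  have h2 : Real.pi ^ ((m : ℝ) ^ 2 * (β : ℝ) / 2 + varrho β m) =
      Real.pi ^ ((m : ℝ) * ((m : ℝ) - 1) * (β : ℝ) / 4) *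
        Real.pi ^ ((m : ℝ) * ((m : ℝ) - 1) * (β : ℝ) / 4) * Real.Gamma ((β : ℝ) / 2) ^ m := by
    rw [Gamma_half_pow_eq hβ, ← Real.rpow_add hpi, ← Real.rpow_add hpi]
    congr 1
    ring
  rw [multivariateGamma, h1, eigenConst, h2, Finset.prod_div_distrib, Finset.prod_mul_distrib,
    prod_range_rpow_eq _ hpi, Finset.prod_const, Finset.card_range]
  have h3 : Real.pi ^ ((m : ℝ) * ((m : ℝ) - 1) * (β : ℝ) / 4) ≠ 0 :=
    (Real.rpow_pos_of_pos hpi _).ne'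
  rw [mul_assoc (Real.pi ^ ((m : ℝ) * ((m : ℝ) - 1) * (β : ℝ) / 4)), mul_div_mul_left _ _ h3]

/-! ### The eigenvalue density -/

namespace RealNormedDivisionAlgebra

variable {F : Type*} [NormedDivisionRing F] [InnerProductSpace ℝ F] [StarRing F]
  [RealNormedDivisionAlgebra F] {m : ℕ}

theorem continuous_conj : Continuous fun p : UGroup F m × Matrix (Fin m) (Fin m) F =>
    (p.1 : Matrix (Fin m) (Fin m) F) * p.2 * (p.1 : Matrix (Fin m) (Fin m) F)ᴴ := by
  fun_prop

variable (F) in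
/-- The matrices `H * diag l * Hᴴ` with `H` unitary and `l ∈ B` strictly decreasing. -/
def simpleSpectrumSet (B : Set (Fin m → ℝ)) : Set (Matrix (Fin m) (Fin m) F) :=
  {S | ∃ (H : UGroup F m) (l : Fin m → ℝ), (StrictAnti l ∧ l ∈ B) ∧
    (H : Matrix (Fin m) (Fin m) F) * realDiagonal F l * (H : Matrix (Fin m) (Fin m) F)ᴴ = S}

theorem conj_mem_simpleSpectrumSet {B : Set (Fin m → ℝ)} (H : UGroup F m) {l : Fin m → ℝ}
    (hl : StrictAnti l) : (H : Matrix (Fin m) (Fin m) F) * realDiagonal F l *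
      (H : Matrix (Fin m) (Fin m) F)ᴴ ∈ simpleSpectrumSet F B ↔ l ∈ B := by
  constructor
  · rintro ⟨H', l', ⟨hl', hB⟩, h⟩
    have := orderedEigenvalues_conj_realDiagonal H' hl'.antitone
    rw [h, orderedEigenvalues_conj_realDiagonal H hl.antitone] at this
    rwa [this]
  · exact fun h => ⟨H, l, ⟨hl, h⟩, rfl⟩

open Classical in
variable (F m) in
/-- A version of `orderedEigenvalues` that is Borel measurable on all matrices: it vanishes away from
the Hermitian matrices with simple spectrum. -/
noncomputable def eigenvalueMap (S : Matrix (Fin m) (Fin m) F) : Fin m → ℝ :=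
  if S ∈ simpleSpectrumSet F Set.univ then orderedEigenvalues S else 0

theorem eigenvalueMap_conj (H : UGroup F m) {l : Fin m → ℝ} (hl : StrictAnti l) :
    eigenvalueMap F m ((H : Matrix (Fin m) (Fin m) F) * realDiagonal F l *
      (H : Matrix (Fin m) (Fin m) F)ᴴ) = l := by
  rw [eigenvalueMap, if_pos ((conj_mem_simpleSpectrumSet H hl).2 (Set.mem_univ l)),
    orderedEigenvalues_conj_realDiagonal H hl.antitone]

variable [MeasurableSpace F] [BorelSpace F]

instance instSecondCountableTopologyMatrix :
    SecondCountableTopology (Matrix (Fin m) (Fin m) F) :=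
  have : ProperSpace F := FiniteDimensional.proper_real F
  inferInstanceAs (SecondCountableTopology (Fin m → Fin m → F))

instance instIsHaarMeasureHaarU : (haarU F m).IsHaarMeasure :=
  Measure.isHaarMeasure_haarMeasure _

instance instIsProbabilityMeasureHaarU : IsProbabilityMeasure (haarU F m) :=
  ⟨Measure.haarMeasure_self⟩

/-- A compact group is unimodular: translates of the normalised Haar measure are normalised Haar
measures. -/
theorem measurePreserving_mul_right_haarU (K : UGroup F m) :
    MeasurePreserving (· * K) (haarU F m) (haarU F m) := by
  have hm : Measurable fun H : UGroup F m => H * K := (continuous_mul_const K).measurable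
  have : IsProbabilityMeasure ((haarU F m).map (· * K)) :=
    Measure.isProbabilityMeasure_map hm.aemeasurable
  exact ⟨hm, Measure.isHaarMeasure_eq_of_isProbabilityMeasure _ _⟩

/-- Weyl's integration formula: a function and its average over unitary conjugations have the
same integral, and the average is invariant. -/
theorem lintegral_hermitianVolume_eq {φ : Matrix (Fin m) (Fin m) F → ENNReal}
    (hφ : Measurable φ) :
    ∫⁻ S, φ S ∂hermitianVolume F m = ENNReal.ofReal (eigenConst (Module.finrank ℝ F) m) *
      ∫⁻ l in {l : Fin m → ℝ | StrictAnti l},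
        ENNReal.ofReal (vandermondeProd l ^ Module.finrank ℝ F) *
          ∫⁻ H : UGroup F m, φ ((H : Matrix (Fin m) (Fin m) F) * realDiagonal F l *
            (H : Matrix (Fin m) (Fin m) F)ᴴ) ∂haarU F m := by
  have : ProperSpace F := FiniteDimensional.proper_real F
  have hsf : SFinite (hermitianVolume F m) := by
    unfold hermitianVolume
    infer_instance
  have hc : Measurable fun p : UGroup F m × Matrix (Fin m) (Fin m) F =>
      φ ((p.1 : Matrix (Fin m) (Fin m) F) * p.2 * (p.1 : Matrix (Fin m) (Fin m) F)ᴴ) :=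
    hφ.comp continuous_conj.measurable
  rw [← lintegral_hermitianVolume_of_invariant (φ := fun S => ∫⁻ H : UGroup F m,
    φ ((H : Matrix (Fin m) (Fin m) F) * S * (H : Matrix (Fin m) (Fin m) F)ᴴ) ∂haarU F m)]
  · rw [lintegral_lintegral_swap (f := fun (S : Matrix (Fin m) (Fin m) F) (H : UGroup F m) =>
      φ ((H : Matrix (Fin m) (Fin m) F) * S * (H : Matrix (Fin m) (Fin m) F)ᴴ))
      (hc.comp measurable_swap).aemeasurable]
    simp only [(measurePreserving_conj (F := F) (Subtype.property _)).lintegral_comp hφ]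
    simp
  · exact (hc.comp measurable_swap).lintegral_prod_right'
  · intro K hK S
    have h := (measurePreserving_mul_right_haarU (F := F) ⟨K, hK⟩).lintegral_comp
      (hc.comp (measurable_prodMk_right (y := S)))
    refine Eq.trans (lintegral_congr fun H => ?_) h
    simp only [Function.comp_apply, Submonoid.coe_mul, Matrix.conjTranspose_mul, Matrix.mul_assoc]

/-- Continuous images of `σ`-compact sets are `σ`-compact, hence Borel. -/
theorem measurableSet_simpleSpectrumSet {B : Set (Fin m → ℝ)} (hB : IsLocallyClosed B) :
    MeasurableSet (simpleSpectrumSet F B) := by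
  have : LocallyCompactSpace ↥({l : Fin m → ℝ | StrictAnti l} ∩ B) :=
    (isOpen_setOf_strictAnti.isLocallyClosed.inter hB).locallyCompactSpace
  have hcont : Continuous fun p : UGroup F m × ↥({l : Fin m → ℝ | StrictAnti l} ∩ B) =>
      (p.1 : Matrix (Fin m) (Fin m) F) * realDiagonal F p.2.1 *
        (p.1 : Matrix (Fin m) (Fin m) F)ᴴ :=
    continuous_conj.comp (continuous_fst.prodMk
      (continuous_realDiagonal.comp (continuous_subtype_val.comp continuous_snd)))
  obtain ⟨K, hK, hKU⟩ := isSigmaCompact_range hcont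
  have e : simpleSpectrumSet F B = ⋃ n, K n := by
    rw [hKU]
    ext S
    constructor
    · rintro ⟨H, l, hl, rfl⟩
      exact ⟨(H, ⟨l, hl⟩), rfl⟩
    · rintro ⟨⟨H, l⟩, rfl⟩
      exact ⟨H, l.1, l.2, rfl⟩
  rw [e]
  exact MeasurableSet.iUnion fun n => (hK n).isClosed.measurableSet

theorem ae_mem_simpleSpectrumSet :
    ∀ᵐ S ∂hermitianVolume F m, S ∈ simpleSpectrumSet F Set.univ := by
  have hG := measurableSet_simpleSpectrumSet (F := F) (m := m) isClosed_univ.isLocallyClosed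
  rw [ae_iff]
  change hermitianVolume F m (simpleSpectrumSet F Set.univ)ᶜ = 0
  rw [← lintegral_indicator_one hG.compl,
    lintegral_hermitianVolume_eq (measurable_one.indicator hG.compl)]
  have h : ∀ l ∈ {l : Fin m → ℝ | StrictAnti l},
      ENNReal.ofReal (vandermondeProd l ^ Module.finrank ℝ F) *
        ∫⁻ H : UGroup F m, (simpleSpectrumSet F Set.univ)ᶜ.indicator 1
          ((H : Matrix (Fin m) (Fin m) F) * realDiagonal F l *
            (H : Matrix (Fin m) (Fin m) F)ᴴ) ∂haarU F m = 0 := by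
    intro l hl
    have : ∀ H : UGroup F m, (simpleSpectrumSet F Set.univ)ᶜ.indicator
        (1 : Matrix (Fin m) (Fin m) F → ENNReal)
        ((H : Matrix (Fin m) (Fin m) F) * realDiagonal F l *
          (H : Matrix (Fin m) (Fin m) F)ᴴ) = 0 := fun H =>
      Set.indicator_of_notMem (Set.notMem_compl_iff.2
        ((conj_mem_simpleSpectrumSet H hl).2 (Set.mem_univ l))) _
    simp [this]
  rw [setLIntegral_congr_fun isOpen_setOf_strictAnti.measurableSet h]
  simp

theorem measurable_eigenvalueMap : Measurable (eigenvalueMap F m) := by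
  have hG := measurableSet_simpleSpectrumSet (F := F) (m := m) isClosed_univ.isLocallyClosed
  -- preimages of closed sets suffice, and these are images of `σ`-compact sets up to a constant part
  refine measurable_of_isClosed fun B hB => ?_
  have e : eigenvalueMap F m ⁻¹' B = simpleSpectrumSet F B ∪
      ((simpleSpectrumSet F Set.univ)ᶜ ∩ {_S | (0 : Fin m → ℝ) ∈ B}) := by
    ext S
    by_cases hS : S ∈ simpleSpectrumSet F Set.univ
    · obtain ⟨H, l, ⟨hl, -⟩, rfl⟩ := hS
      rw [Set.mem_preimage, eigenvalueMap_conj H hl, Set.mem_union,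
        conj_mem_simpleSpectrumSet H hl, Set.mem_inter_iff, Set.mem_compl_iff,
        conj_mem_simpleSpectrumSet H hl]
      simp
    · have hS' : S ∉ simpleSpectrumSet F B := fun ⟨H, l, h, h'⟩ => hS ⟨H, l, ⟨h.1, trivial⟩, h'⟩
      rw [Set.mem_preimage, eigenvalueMap, if_neg hS]
      simp [hS, hS']
  rw [e]
  exact (measurableSet_simpleSpectrumSet hB.isLocallyClosed).union
    (hG.compl.inter (MeasurableSet.const _))

theorem orderedEigenvalues_ae_eq :
    orderedEigenvalues =ᵐ[hermitianVolume F m] eigenvalueMap F m :=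
  ae_mem_simpleSpectrumSet.mono fun S hS => by rw [eigenvalueMap, if_pos hS]

theorem setOf_isPosDefHermitian_ae_eq :
    {S : Matrix (Fin m) (Fin m) F | IsPosDefHermitian S} =ᵐ[hermitianVolume F m]
      simpleSpectrumSet F {l | ∀ i, 0 < l i} := by
  refine ae_mem_simpleSpectrumSet.mono fun S hS => ?_
  obtain ⟨H, l, ⟨hl, -⟩, rfl⟩ := hS
  exact propext ((isPosDefHermitian_conj_realDiagonal H l).trans
    (conj_mem_simpleSpectrumSet (B := {l | ∀ i, 0 < l i}) H hl).symm)

theorem isOpen_setOf_forall_pos : IsOpen {l : Fin m → ℝ | ∀ i, 0 < l i} := by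
  simp only [Set.ofPred_forall]
  exact isOpen_iInter_of_finite fun i => isOpen_lt continuous_const (continuous_apply i)

/-- The law of the eigenvalues of a positive definite matrix with density `f`. -/
theorem map_eigenvalueMap_withDensity {f : Matrix (Fin m) (Fin m) F → ENNReal}
    (hf : Measurable f) :
    (((hermitianVolume F m).restrict {S | IsPosDefHermitian S}).withDensity f).map
        (eigenvalueMap F m) =
      ((volume : Measure (Fin m → ℝ)).restrict {l | StrictAnti l ∧ ∀ i, 0 < l i}).withDensity
        fun l => ENNReal.ofReal (eigenConst (Module.finrank ℝ F) m) *
          (ENNReal.ofReal (vandermondeProd l ^ Module.finrank ℝ F) *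
            ∫⁻ H : UGroup F m, f ((H : Matrix (Fin m) (Fin m) F) * realDiagonal F l *
              (H : Matrix (Fin m) (Fin m) F)ᴴ) ∂haarU F m) := by
  have hpos := measurableSet_simpleSpectrumSet (F := F)
    (isOpen_setOf_forall_pos (m := m)).isLocallyClosed
  have hSA : MeasurableSet {l : Fin m → ℝ | StrictAnti l} := isOpen_setOf_strictAnti.measurableSet
  ext B hB
  have hpre := measurable_eigenvalueMap (F := F) hB
  have hD : MeasurableSet ({l : Fin m → ℝ | ∀ i, 0 < l i} ∩ B) :=
    isOpen_setOf_forall_pos.measurableSet.inter hB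
  rw [Measure.map_apply measurable_eigenvalueMap hB, withDensity_apply _ hpre,
    withDensity_apply _ hB, Measure.restrict_congr_set setOf_isPosDefHermitian_ae_eq,
    Measure.restrict_restrict hpre, Measure.restrict_restrict hB,
    ← lintegral_indicator (hpre.inter hpos),
    lintegral_hermitianVolume_eq (hf.indicator (hpre.inter hpos)),
    lintegral_const_mul' _ _ ENNReal.ofReal_ne_top]
  congr 1
  have hset : B ∩ {l : Fin m → ℝ | StrictAnti l ∧ ∀ i, 0 < l i} =
      ({l : Fin m → ℝ | ∀ i, 0 < l i} ∩ B) ∩ {l | StrictAnti l} := by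
    ext l
    simp only [Set.mem_inter_iff, Set.mem_ofPred_eq]
    tauto
  rw [hset, ← Measure.restrict_restrict hD, ← lintegral_indicator hD]
  refine setLIntegral_congr_fun hSA fun l hl => ?_
  have hmem : ∀ H : UGroup F m, (H : Matrix (Fin m) (Fin m) F) * realDiagonal F l *
      (H : Matrix (Fin m) (Fin m) F)ᴴ ∈ eigenvalueMap F m ⁻¹' B ∩
        simpleSpectrumSet F {l | ∀ i, 0 < l i} ↔ l ∈ {l : Fin m → ℝ | ∀ i, 0 < l i} ∩ B := by
    intro H
    rw [Set.mem_inter_iff, Set.mem_preimage, eigenvalueMap_conj H hl,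
      conj_mem_simpleSpectrumSet H hl, and_comm]
    rfl
  by_cases h : l ∈ {l : Fin m → ℝ | ∀ i, 0 < l i} ∩ B
  · rw [Set.indicator_of_mem h]
    congr 1
    exact lintegral_congr fun H => Set.indicator_of_mem ((hmem H).2 h) _
  · rw [Set.indicator_of_notMem h, lintegral_congr fun H =>
      Set.indicator_of_notMem (fun h' => h ((hmem H).1 h')) _]
    simp

end RealNormedDivisionAlgebra

theorem mainTheorem12 {F : Type*} [NormedDivisionRing F] [InnerProductSpace ℝ F] [StarRing F]
    [RealNormedDivisionAlgebra F] [MeasurableSpace F] [BorelSpace F]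
    (β : ℕ) (hβ : β = Module.finrank ℝ F) (m : ℕ)
    {Ω : Type*} [MeasurableSpace Ω] (P : Measure Ω) [IsProbabilityMeasure P]
    (X : Ω → Matrix (Fin m) (Fin m) F) (hX : AEMeasurable X P)
    (hpos : ∀ᵐ ω ∂P, IsPosDefHermitian (X ω))
    (f : Matrix (Fin m) (Fin m) F → ENNReal) (hf : Measurable f)
    (hdens : P.map X =
      ((hermitianVolume F m).restrict {S | IsPosDefHermitian S}).withDensity f) :
    AEMeasurable (fun ω => orderedEigenvalues (X ω)) P ∧
    P.map (fun ω => orderedEigenvalues (X ω)) =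
      ((volume : Measure (Fin m → ℝ)).restrict {l | StrictAnti l ∧ ∀ i, 0 < l i}).withDensity
        (fun l =>
          ENNReal.ofReal
            (Real.pi ^ ((m : ℝ) ^ 2 * (β : ℝ) / 2 + varrho β m) /
                multivariateGamma β m ((m : ℝ) * (β : ℝ) / 2) *
              ∏ i : Fin m, ∏ j ∈ Finset.Ioi i, (l i - l j) ^ β) *
          ∫⁻ H : UGroup F m,
            f ((H : Matrix (Fin m) (Fin m) F) *
                Matrix.diagonal (fun i => l i • (1 : F)) *
              (H : Matrix (Fin m) (Fin m) F)ᴴ) ∂(haarU F m)) := by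
  subst hβ
  have hac : P.map X ≪ hermitianVolume F m := by
    rw [hdens]
    exact (withDensity_absolutelyContinuous _ _).trans Measure.absolutelyContinuous_restrict
  have hae : (fun ω => orderedEigenvalues (X ω)) =ᵐ[P]
      fun ω => RealNormedDivisionAlgebra.eigenvalueMap F m (X ω) :=
    ae_of_ae_map hX (hac.ae_le RealNormedDivisionAlgebra.orderedEigenvalues_ae_eq)
  have hmeas := RealNormedDivisionAlgebra.measurable_eigenvalueMap (F := F) (m := m)
  refine ⟨(hmeas.comp_aemeasurable hX).congr hae.symm, ?_⟩
  rw [Measure.map_congr hae]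
  change P.map (RealNormedDivisionAlgebra.eigenvalueMap F m ∘ X) = _
  rw [← AEMeasurable.map_map_of_aemeasurable hmeas.aemeasurable hX, hdens,
    RealNormedDivisionAlgebra.map_eigenvalueMap_withDensity hf]
  congr 1
  ext l
  have hprod : ∏ i : Fin m, ∏ j ∈ Finset.Ioi i, (l i - l j) ^ Module.finrank ℝ F =
      vandermondeProd l ^ Module.finrank ℝ F := by
    simp only [vandermondeProd, Finset.prod_pow]
  rw [hprod, ← eigenConst_eq RealNormedDivisionAlgebra.finrank_eq_one_or_two_or_four,
    ENNReal.ofReal_mul (eigenConst_pos Module.finrank_pos m).le, mul_assoc]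
  rfl
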